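/- Let $N\in\mathbb N$, $T>0$, $\alpha\in(0,1)$, and let $H:\mathbb R^N\times\mathbb R^N\to\mathbb R$ be continuous and $u_0:\mathbb R^N\to\mathbb R$. Assume (A1) $\lim_{r\to\infty}\inf\{H(y,p) : y\in\mathbb R^N,\ |p|\ge r\}=\infty$; (A2) $H(y+k,p)=H(y,p)$ for all $y,p\in\mathbb R^N$, $k\in\mathbb Z^N$; (A3) $u_0$ is Lipschitz continuous, bounded and uniformly continuous on $\mathbb R^N$. For $\varepsilon>0$ consider the problem $$\partial_t^\alpha u^\varepsilon+H\Big(\frac x\varepsilon,Du^\varepsilon\Big)=0\ \text{ in }\mathbb R^N\times(0,T),\qquad u^\varepsilon(\cdot,0)=u_0\ \text{ on }\mathbb R^N,\tag{1}$$ where $\partial^\alpha_t$ is the Caputo derivative, understood through $\partial_t^\alpha f(t)=J[f](t)+K[f](t)$ with $$J[f](t)=\frac{f(t)-f(0)}{t^\alpha\,\Gamma(1-\alpha)},\qquad K[f](t)=\frac{\alpha}{\Gamma(1-\alpha)}\int_0^t\frac{f(t)-f(t-\tau)}{\tau^{\alpha+1}}\,d\tau .$$ A function $u\in C(\mathbb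 R^N\times[0,T])$ is a viscosity solution of (1) if $u(\cdot,0)=u_0$ and, for every $\varphi\in C^1(\mathbb R^N\times(0,T])\cap C(\mathbb R^N\times[0,T])$ and every $(\hat x,\hat t)\in\mathbb R^N\times(0,T]$, the quantity $$J[\varphi(\hat x,\cdot)](\hat t)+K[\varphi(\hat x,\cdot)](\hat t)+H\Big(\frac{\hat x}{\varepsilon},D\varphi(\hat x,\hat t)\Big)$$ is $\le 0$ if $u-\varphi$ attains its maximum over $\mathbb R^N\times[0,T]$ at $(\hat x,\hat t)$, and is $\ge 0$ if $u-\varphi$ attains its minimum over $\mathbb R^N\times[0,T]$ at $(\hat x,\hat t)$. Below, $u^\varepsilon$ denotes any bounded viscosity solution of (1). (i) There is a modulus of continuity $\omega\in C([0,\infty))$ (continuous, nondecreasing, $\omega(0)=0$), independent of $\varepsilon$, such that for all $\varepsilon>0$ $$|u^\varepsilon(x,t)-u^\varepsilon(y,t)|\le\omega(|x-y|)\qquad\text{for all }x,y\in\mathbb R^N,\ t\in[0,T].$$ (ii) Assume in addition (A5): there is $C_0>0$ such that $H(x,p)\ge C_0^{-1}|p|-C_0$ for all $x,p\in\mathbb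 R^N$. Then there is a constant $C>0$, independent of $\varepsilon$, such that for all $\varepsilon>0$ $$|u^\varepsilon(x,t)-u^\varepsilon(y,t)|\le C\big(1+\big|\log|x-y|\big|\big)|x-y|\qquad\text{for all }x,y\in\mathbb R^N,\ t\in[0,T],$$ where the right-hand side is read as $0$ if $x=y$. In particular, for each $\nu\in(0,1)$ there is a constant $C>0$, independent of $\varepsilon$, such that for all $\varepsilon>0$ $$|u^\varepsilon(x,t)-u^\varepsilon(y,t)|\le C|x-y|^\nu\qquad\text{for all }x,y\in\mathbb R^N,\ t\in[0,T].$$ -/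

import Mathlib

open Set Filter Topology

namespace TFHJ

noncomputable section

/-- The space `ℝ^N` with its Euclidean norm. -/
abbrev Space (N : ℕ) : Type := EuclideanSpace ℝ (Fin N)

/-- The closed space-time domain `ℝ^N × [0, T]`. -/
def closedDomain (N : ℕ) (T : ℝ) : Set (Space N × ℝ) := univ ×ˢ Icc 0 T

/-- The domain `ℝ^N × (0, T]`, where the equation is tested. -/
def testDomain (N : ℕ) (T : ℝ) : Set (Space N × ℝ) := univ ×ˢ Ioc 0 T

/-- Coercivity, uniform in the first variable:
`lim_{r → ∞} inf {H(y, p) | y ∈ ℝ^N, |p| ≥ r} = ∞`. The infimum is taken in `[-∞, ∞]`. -/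
def Coercive {N : ℕ} (H : Space N → Space N → ℝ) : Prop :=
  Tendsto (fun r : ℝ => ⨅ (y : Space N) (p : Space N) (_ : r ≤ ‖p‖), (H y p : EReal))
    atTop (𝓝 ⊤)

/-- `ℤ^N`-periodicity in the first variable. -/
def Periodic {N : ℕ} (H : Space N → Space N → ℝ) : Prop :=
  ∀ (y p : Space N) (k : Fin N → ℤ), H (y + WithLp.toLp 2 (fun i => (k i : ℝ))) p = H y p

/-- `u₀ ∈ Lip(ℝ^N) ∩ BUC(ℝ^N)`. -/
def LipBUC {N : ℕ} (u₀ : Space N → ℝ) : Prop :=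
  (∃ K : NNReal, LipschitzWith K u₀) ∧ UniformContinuous u₀ ∧ ∃ B : ℝ, ∀ x, |u₀ x| ≤ B

/-- At least linear growth: `H(x, p) ≥ C⁻¹ |p| - C` for some `C > 0`. -/
def LinearGrowth {N : ℕ} (H : Space N → Space N → ℝ) : Prop :=
  ∃ C : ℝ, 0 < C ∧ ∀ x p : Space N, C⁻¹ * ‖p‖ - C ≤ H x p

/-- `J[f](t) = (f(t) - f(0)) / (t^α Γ(1 - α))`. -/
def caputoJ (α : ℝ) (f : ℝ → ℝ) (t : ℝ) : ℝ :=
  (f t - f 0) / (t ^ α * Real.Gamma (1 - α))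

/-- `K_{(a,b)}[f](t) = α / Γ(1 - α) ∫_a^b (f(t) - f(t - τ)) / τ^(α + 1) dτ`. -/
def caputoK (α a b : ℝ) (f : ℝ → ℝ) (t : ℝ) : ℝ :=
  α / Real.Gamma (1 - α) * ∫ τ in a..b, (f t - f (t - τ)) / τ ^ (α + 1)

/-- Test functions: `φ ∈ C¹(ℝ^N × (0, T]) ∩ C(ℝ^N × [0, T])`. -/
def IsTestFunction {N : ℕ} (T : ℝ) (φ : Space N → ℝ → ℝ) : Prop :=
  ContDiffOn ℝ 1 (Function.uncurry φ) (testDomain N T) ∧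
    ContinuousOn (Function.uncurry φ) (closedDomain N T)

/-- The left-hand side `J[φ] + K_{(0,t)}[φ] + H(x/ε, Dφ)` at `(x, t)`, with `D` the spatial
gradient. For a test function `φ`, `J[φ] + K_{(0,t)}[φ]` is the Caputo derivative of order `α`
of `φ(x, ·)` at `t`, and its integrand is integrable. -/
def operator {N : ℕ} (α ε : ℝ) (H : Space N → Space N → ℝ) (φ : Space N → ℝ → ℝ)
    (x : Space N) (t : ℝ) : ℝ :=
  caputoJ α (φ x) t + caputoK α 0 t (φ x) t + H (ε⁻¹ • x) (gradient (fun z => φ z t) x)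

/-- Viscosity subsolution of `∂_t^α u + H(x/ε, Du) = 0`, `u(·, 0) = u₀`. Only the values of `u`
on `ℝ^N × [0, T]` matter. -/
def IsSubsolution {N : ℕ} (T α ε : ℝ) (H : Space N → Space N → ℝ) (u₀ : Space N → ℝ)
    (u : Space N → ℝ → ℝ) : Prop :=
  UpperSemicontinuousOn (Function.uncurry u) (closedDomain N T) ∧
    (∀ x, u x 0 ≤ u₀ x) ∧
    ∀ φ : Space N → ℝ → ℝ, IsTestFunction T φ → ∀ (x : Space N) (t : ℝ), t ∈ Ioc 0 T →
      IsMaxOn (fun z : Space N × ℝ => u z.1 z.2 - φ z.1 z.2) (closedDomain N T) (x, t) →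
      operator α ε H φ x t ≤ 0

/-- Viscosity supersolution of `∂_t^α u + H(x/ε, Du) = 0`, `u(·, 0) = u₀`. -/
def IsSupersolution {N : ℕ} (T α ε : ℝ) (H : Space N → Space N → ℝ) (u₀ : Space N → ℝ)
    (u : Space N → ℝ → ℝ) : Prop :=
  LowerSemicontinuousOn (Function.uncurry u) (closedDomain N T) ∧
    (∀ x, u₀ x ≤ u x 0) ∧
    ∀ φ : Space N → ℝ → ℝ, IsTestFunction T φ → ∀ (x : Space N) (t : ℝ), t ∈ Ioc 0 T →
      IsMinOn (fun z : Space N × ℝ => u z.1 z.2 - φ z.1 z.2) (closedDomain N T) (x, t) →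
      0 ≤ operator α ε H φ x t

/-- Viscosity solution: continuous on `ℝ^N × [0, T]`, and both a sub- and a supersolution. -/
def IsViscositySolution {N : ℕ} (T α ε : ℝ) (H : Space N → Space N → ℝ) (u₀ : Space N → ℝ)
    (u : Space N → ℝ → ℝ) : Prop :=
  ContinuousOn (Function.uncurry u) (closedDomain N T) ∧
    IsSubsolution T α ε H u₀ u ∧ IsSupersolution T α ε H u₀ u

/-- Boundedness on `ℝ^N × [0, T]`; the bound may depend on `u`. -/
def IsBounded {N : ℕ} (T : ℝ) (u : Space N → ℝ → ℝ) : Prop :=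
  ∃ B : ℝ, ∀ (x : Space N), ∀ t ∈ Icc 0 T, |u x t| ≤ B

/-- Modulus of continuity `ω ∈ C([0, ∞))`: continuous, nondecreasing, `ω(0) = 0`
(so `ω ≥ 0`). -/
def IsModulus (ω : ℝ → ℝ) : Prop :=
  ContinuousOn ω (Ici 0) ∧ MonotoneOn ω (Ici 0) ∧ ω 0 = 0

end

end TFHJ

/-
A barrier `u₀ y + L|x - y| + C t^α` gives `|u - u₀| ≤ C t^α`. Doubling the variables in space and
time at a maximum, and comparing the two memory integrals, turns this into the Hölder estimate
`|u(x, t) - u(x, s)| ≤ C|t - s|^α`; the slope of the penalty in space is controlled there by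
coercivity. The barrier `2R|x - y| + C(|t - s|² + η²)^{α/2}` in `(y, s)` has Caputo derivative
at least `-A(1 + log(1/η))`. If `H > A(1 + log(1/η))` on `|p| ≥ R`, then `u` minus the barrier can
only be maximal at the vertex, whence, by the time estimate,
`|u(x, t) - u(y, t)| ≤ 2R|x - y| + Cη^α`. Taking the infimum over `η` gives the modulus, and
`η = |x - y|^{1/α}` the logarithmic estimate when `H` grows linearly.
-/

open MeasureTheory

namespace TFHJ

noncomputable section

variable {N : ℕ}

/-- Uniform continuity and boundedness of `H` on the sets `ℝ^N × {|p| ≤ R}`, which replaces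
periodicity as the compactness property of `H`. -/
def IsLocallyBUC (H : Space N → Space N → ℝ) : Prop :=
  ∀ R : ℝ, UniformContinuousOn (Function.uncurry H) (univ ×ˢ Metric.closedBall 0 R) ∧
    ∃ A : ℝ, ∀ y p, ‖p‖ ≤ R → |H y p| ≤ A

theorem exists_norm_add_intVector_le (x : Space N) :
    ∃ k : Fin N → ℤ, ‖x + WithLp.toLp 2 (fun i => (k i : ℝ))‖ ≤ √N := by
  refine ⟨fun i => -⌊x i⌋, ?_⟩
  have hfract : ∀ i, (x + WithLp.toLp 2 (fun i => ((-⌊x i⌋ : ℤ) : ℝ))) i = Int.fract (x i) :=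
    fun i => by simp [Int.fract, sub_eq_add_neg]
  rw [EuclideanSpace.norm_eq]
  refine Real.sqrt_le_sqrt ?_
  calc ∑ i, ‖(x + WithLp.toLp 2 (fun i => ((-⌊x i⌋ : ℤ) : ℝ))) i‖ ^ 2
      ≤ ∑ _i : Fin N, (1 : ℝ) := by
        refine Finset.sum_le_sum fun i _ => pow_le_one₀ (norm_nonneg _) ?_
        rw [hfract, Real.norm_of_nonneg (Int.fract_nonneg _)]
        exact (Int.fract_lt_one _).le
    _ = N := by simp

theorem Periodic.uniformContinuousOn {H : Space N → Space N → ℝ} (hP : Periodic H)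
    (hH : Continuous (Function.uncurry H)) (R : ℝ) :
    UniformContinuousOn (Function.uncurry H) (univ ×ˢ Metric.closedBall 0 R) := by
  have hK : IsCompact
      (Metric.closedBall (0 : Space N) (√N + 1) ×ˢ Metric.closedBall (0 : Space N) R) :=
    (isCompact_closedBall _ _).prod (isCompact_closedBall _ _)
  have hUC := hK.uniformContinuousOn_of_continuous hH.continuousOn
  rw [Metric.uniformContinuousOn_iff] at hUC ⊢
  intro e he
  obtain ⟨d, hd, hUC⟩ := hUC e he
  refine ⟨min d 1, by positivity, fun ⟨x, p⟩ ⟨_, hp⟩ ⟨y, q⟩ ⟨_, hq⟩ hdist => ?_⟩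
  obtain ⟨k, hk⟩ := exists_norm_add_intVector_le x
  set v : Space N := WithLp.toLp 2 (fun i => (k i : ℝ))
  have hxy : dist x y < min d 1 := (le_max_left _ _).trans_lt hdist
  have hx : x + v ∈ Metric.closedBall (0 : Space N) (√N + 1) := by
    rw [mem_closedBall_zero_iff]
    linarith
  have hy : y + v ∈ Metric.closedBall (0 : Space N) (√N + 1) := by
    rw [mem_closedBall_zero_iff, show y + v = (x + v) - (x - y) by abel]
    have h1 := dist_eq_norm x y ▸ hxy.trans_le (min_le_right d 1)
    linarith [norm_sub_le (x + v) (x - y)]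
  have h := hUC (x + v, p) ⟨hx, hp⟩ (y + v, q) ⟨hy, hq⟩ (by
    rw [Prod.dist_eq, dist_add_right]
    exact hdist.trans_le (min_le_left d 1))
  simpa only [Function.uncurry, hP x p k, hP y q k, v] using h

theorem Periodic.exists_bound {H : Space N → Space N → ℝ} (hP : Periodic H)
    (hH : Continuous (Function.uncurry H)) (R : ℝ) : ∃ A : ℝ, ∀ y p, ‖p‖ ≤ R → |H y p| ≤ A := by
  have hK : IsCompact (Metric.closedBall (0 : Space N) (√N) ×ˢ Metric.closedBall (0 : Space N) R) :=
    (isCompact_closedBall _ _).prod (isCompact_closedBall _ _)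
  obtain ⟨A, hA⟩ := hK.exists_bound_of_continuousOn hH.continuousOn
  refine ⟨A, fun y p hp => ?_⟩
  obtain ⟨k, hk⟩ := exists_norm_add_intVector_le y
  rw [← hP y p k]
  exact hA (_, p) ⟨mem_closedBall_zero_iff.2 hk, mem_closedBall_zero_iff.2 hp⟩

theorem Periodic.isLocallyBUC {H : Space N → Space N → ℝ} (hP : Periodic H)
    (hH : Continuous (Function.uncurry H)) : IsLocallyBUC H :=
  fun R => ⟨hP.uniformContinuousOn hH R, hP.exists_bound hH R⟩

theorem IsLocallyBUC.exists_forall_norm_sub_lt {H : Space N → Space N → ℝ} (hH : IsLocallyBUC H)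
    (R : ℝ) {e : ℝ} (he : 0 < e) :
    ∃ d : ℝ, 0 < d ∧ ∀ x y p q, ‖p‖ ≤ R → ‖q‖ ≤ R → ‖x - y‖ < d → ‖p - q‖ < d →
      |H x p - H y q| < e := by
  obtain ⟨d, hd, hUC⟩ := Metric.uniformContinuousOn_iff.1 (hH R).1 e he
  refine ⟨d, hd, fun x y p q hp hq hxy hpq => ?_⟩
  refine hUC (x, p) ⟨mem_univ _, mem_closedBall_zero_iff.2 hp⟩ (y, q)
    ⟨mem_univ _, mem_closedBall_zero_iff.2 hq⟩ ?_
  rw [Prod.dist_eq, max_lt_iff, dist_eq_norm, dist_eq_norm]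
  exact ⟨hxy, hpq⟩

theorem Coercive.exists_radius {H : Space N → Space N → ℝ} (hC : Coercive H) (A : ℝ) :
    ∃ R : ℝ, ∀ y p, R ≤ ‖p‖ → A < H y p := by
  obtain ⟨R, hR⟩ := (hC.eventually (lt_mem_nhds (EReal.coe_lt_top A))).exists
  refine ⟨R, fun y p hp => EReal.coe_lt_coe_iff.1 ?_⟩
  exact hR.trans_le ((iInf_le _ y).trans ((iInf_le _ p).trans (iInf_le _ hp)))

theorem LinearGrowth.exists_radius {H : Space N → Space N → ℝ} (hG : LinearGrowth H) :
    ∃ K : ℝ, 0 < K ∧ ∀ A : ℝ, 0 ≤ A → ∀ y p, K * (1 + A) ≤ ‖p‖ → A < H y p := by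
  obtain ⟨C, hC, hG⟩ := hG
  refine ⟨C * (C + 1), by positivity, fun A hA y p hp => ?_⟩
  have h : (C + 1) * (1 + A) ≤ C⁻¹ * ‖p‖ := by
    rw [le_inv_mul_iff₀ hC]
    linarith
  nlinarith [hG y p]

section SmoothNorm

variable {E : Type*} [NormedAddCommGroup E]

/-- The regularised norm `√(‖x‖² + σ²)`, a `C¹` test function in place of `‖x‖`. -/
def smoothNorm (σ : ℝ) (x : E) : ℝ := √(‖x‖ ^ 2 + σ ^ 2)

theorem norm_le_smoothNorm (σ : ℝ) (x : E) : ‖x‖ ≤ smoothNorm σ x :=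
  Real.le_sqrt_of_sq_le (by nlinarith [sq_nonneg σ])

theorem le_smoothNorm (σ : ℝ) (x : E) : σ ≤ smoothNorm σ x :=
  Real.le_sqrt_of_sq_le (by nlinarith [sq_nonneg ‖x‖])

theorem smoothNorm_nonneg (σ : ℝ) (x : E) : 0 ≤ smoothNorm σ x := Real.sqrt_nonneg _

theorem smoothNorm_pos {σ : ℝ} (hσ : 0 < σ) (x : E) : 0 < smoothNorm σ x :=
  hσ.trans_le (le_smoothNorm σ x)

theorem smoothNorm_zero {σ : ℝ} (hσ : 0 ≤ σ) : smoothNorm σ (0 : E) = σ := by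
  simp [smoothNorm, Real.sqrt_sq hσ]

theorem smoothNorm_mono (σ : ℝ) {x y : E} (h : ‖x‖ ≤ ‖y‖) : smoothNorm σ x ≤ smoothNorm σ y :=
  Real.sqrt_le_sqrt (by gcongr)

theorem abs_smoothNorm_sub_le (σ : ℝ) (x y : E) :
    |smoothNorm σ x - smoothNorm σ y| ≤ ‖x - y‖ := by
  have h : ∀ z : E, smoothNorm σ z = ‖WithLp.toLp 2 (z, σ)‖ := fun z => by
    simp [smoothNorm, WithLp.prod_norm_eq_of_L2]
  have hsub : ‖WithLp.toLp 2 (x, σ) - WithLp.toLp 2 (y, σ)‖ = ‖x - y‖ := by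
    simp [WithLp.prod_norm_eq_of_L2]
  rw [h, h, ← hsub]
  exact abs_norm_sub_norm_le _ _

theorem smoothNorm_le_norm_add {σ : ℝ} (hσ : 0 ≤ σ) (x : E) : smoothNorm σ x ≤ ‖x‖ + σ := by
  have h := (abs_le.1 (abs_smoothNorm_sub_le σ x 0)).2
  rw [smoothNorm_zero hσ, sub_zero] at h
  linarith

variable [InnerProductSpace ℝ E]

theorem contDiff_smoothNorm {σ : ℝ} (hσ : 0 < σ) : ContDiff ℝ 1 (smoothNorm σ : E → ℝ) :=
  ((contDiff_norm_sq ℝ).add contDiff_const).sqrt fun x => by positivity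

theorem norm_smoothNorm_inv_smul_le {σ : ℝ} (hσ : 0 < σ) (x : E) :
    ‖(smoothNorm σ x)⁻¹ • x‖ ≤ 1 := by
  have h := smoothNorm_pos hσ x
  rw [norm_smul, norm_inv, Real.norm_of_nonneg h.le, inv_mul_le_iff₀ h, mul_one]
  exact norm_le_smoothNorm σ x

variable [CompleteSpace E]

theorem hasGradientAt_add {f g : E → ℝ} {p q x : E} (hf : HasGradientAt f p x)
    (hg : HasGradientAt g q x) : HasGradientAt (fun z => f z + g z) (p + q) x := by
  rw [hasGradientAt_iff_hasFDerivAt, map_add]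
  exact hf.hasFDerivAt.add hg.hasFDerivAt

theorem hasGradientAt_const_mul {f : E → ℝ} {p x : E} (hf : HasGradientAt f p x) (c : ℝ) :
    HasGradientAt (fun z => c * f z) (c • p) x := by
  rw [hasGradientAt_iff_hasFDerivAt, map_smul]
  exact hf.hasFDerivAt.const_mul c

theorem hasGradientAt_norm_sq_sub (a x : E) :
    HasGradientAt (fun z : E => ‖z - a‖ ^ 2) ((2 : ℝ) • (x - a)) x := by
  rw [hasGradientAt_iff_hasFDerivAt]
  refine ((hasFDerivAt_id x).sub_const a).norm_sq.congr_fderiv ?_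
  ext v
  simp [InnerProductSpace.toDual_apply_apply]

theorem hasGradientAt_smoothNorm_sub {σ : ℝ} (hσ : 0 < σ) (a x : E) :
    HasGradientAt (fun z => smoothNorm σ (z - a)) ((smoothNorm σ (x - a))⁻¹ • (x - a)) x := by
  rw [hasGradientAt_iff_hasFDerivAt]
  have h := ((hasGradientAt_norm_sq_sub a x).hasFDerivAt.add_const (σ ^ 2)).sqrt (by positivity)
  refine h.congr_fderiv ?_
  ext v
  simp only [smul_apply, InnerProductSpace.toDual_apply_apply,
    inner_smul_left, smoothNorm, smul_eq_mul, RCLike.conj_to_real]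
  field_simp

end SmoothNorm

/-- The regularised power `M (r² + η²) ^ (α / 2)`, which replaces `M |r| ^ α` in time barriers. -/
def smoothPow (α M η r : ℝ) : ℝ := M * smoothNorm η r ^ α

theorem contDiff_smoothPow (α M : ℝ) {η : ℝ} (hη : 0 < η) : ContDiff ℝ 1 (smoothPow α M η) :=
  contDiff_const.mul ((contDiff_smoothNorm hη).rpow_const_of_ne fun r => (smoothNorm_pos hη r).ne')

theorem abs_rpow_sub_rpow_le {α x y : ℝ} (hα₀ : 0 ≤ α) (hα₁ : α ≤ 1) (hx : 0 ≤ x) (hy : 0 ≤ y) :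
    |x ^ α - y ^ α| ≤ |x - y| ^ α := by
  wlog hxy : y ≤ x generalizing x y
  · rw [abs_sub_comm, abs_sub_comm x]
    exact this hy hx (le_of_not_ge hxy)
  rw [abs_of_nonneg (sub_nonneg.2 (by gcongr)), abs_of_nonneg (sub_nonneg.2 hxy)]
  have h := Real.rpow_add_le_add_rpow hy (sub_nonneg.2 hxy) hα₀ hα₁
  rw [add_sub_cancel] at h
  linarith

theorem abs_rpow_sub_rpow_le_mul {α η x y : ℝ} (hα₀ : 0 ≤ α) (hα₁ : α ≤ 1) (hη : 0 < η)
    (hx : η ≤ x) (hy : η ≤ y) : |x ^ α - y ^ α| ≤ η ^ (α - 1) * |x - y| := by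
  wlog hxy : y ≤ x generalizing x y
  · rw [abs_sub_comm, abs_sub_comm x]
    exact this hy hx (le_of_not_ge hxy)
  have hy₀ : 0 < y := hη.trans_le hy
  have hx₀ : 0 < x := hη.trans_le hx
  have hfactor : ∀ z : ℝ, 0 < z → z ^ α = z ^ (α - 1) * z := fun z hz => by
    rw [← Real.rpow_add_one hz.ne', sub_add_cancel]
  rw [abs_of_nonneg (sub_nonneg.2 (by gcongr)), abs_of_nonneg (sub_nonneg.2 hxy)]
  calc x ^ α - y ^ α = x ^ (α - 1) * x - y ^ (α - 1) * y := by rw [hfactor x hx₀, hfactor y hy₀]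
    _ ≤ y ^ (α - 1) * x - y ^ (α - 1) * y := by
        have := Real.rpow_le_rpow_of_nonpos hy₀ hxy (by linarith : α - 1 ≤ 0)
        gcongr
    _ = y ^ (α - 1) * (x - y) := by ring
    _ ≤ η ^ (α - 1) * (x - y) :=
        mul_le_mul_of_nonneg_right (Real.rpow_le_rpow_of_nonpos hη hy (by linarith))
          (sub_nonneg.2 hxy)

section SmoothPow

variable {α M η : ℝ}

theorem abs_smoothPow_sub_le_rpow (hα₀ : 0 ≤ α) (hα₁ : α ≤ 1) (hM : 0 ≤ M) (η a b : ℝ) :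
    |smoothPow α M η a - smoothPow α M η b| ≤ M * |a - b| ^ α := by
  rw [smoothPow, smoothPow, ← mul_sub, abs_mul, abs_of_nonneg hM]
  gcongr
  calc |smoothNorm η a ^ α - smoothNorm η b ^ α| ≤ |smoothNorm η a - smoothNorm η b| ^ α :=
        abs_rpow_sub_rpow_le hα₀ hα₁ (smoothNorm_nonneg _ _) (smoothNorm_nonneg _ _)
    _ ≤ |a - b| ^ α := Real.rpow_le_rpow (abs_nonneg _) (abs_smoothNorm_sub_le η a b) hα₀

theorem abs_smoothPow_sub_le_mul (hα₀ : 0 ≤ α) (hα₁ : α ≤ 1) (hM : 0 ≤ M) (hη : 0 < η)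
    (a b : ℝ) : |smoothPow α M η a - smoothPow α M η b| ≤ M * η ^ (α - 1) * |a - b| := by
  rw [smoothPow, smoothPow, ← mul_sub, abs_mul, abs_of_nonneg hM, mul_assoc]
  gcongr
  calc |smoothNorm η a ^ α - smoothNorm η b ^ α|
      ≤ η ^ (α - 1) * |smoothNorm η a - smoothNorm η b| :=
        abs_rpow_sub_rpow_le_mul hα₀ hα₁ hη (le_smoothNorm _ _) (le_smoothNorm _ _)
    _ ≤ η ^ (α - 1) * |a - b| :=
        mul_le_mul_of_nonneg_left (abs_smoothNorm_sub_le η a b) (Real.rpow_nonneg hη.le _)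

theorem mul_abs_rpow_le_smoothPow (hα : 0 ≤ α) (hM : 0 ≤ M) (η r : ℝ) :
    M * |r| ^ α ≤ smoothPow α M η r := by
  unfold smoothPow
  gcongr
  exact norm_le_smoothNorm η r

theorem smoothPow_mono (hα : 0 ≤ α) (hM : 0 ≤ M) (η : ℝ) {r s : ℝ} (h : |r| ≤ |s|) :
    smoothPow α M η r ≤ smoothPow α M η s := by
  have := smoothNorm_nonneg η r
  unfold smoothPow
  gcongr
  exact smoothNorm_mono η h

theorem smoothPow_zero (hη : 0 ≤ η) : smoothPow α M η 0 = M * η ^ α := by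
  rw [smoothPow, smoothNorm_zero hη]

theorem smoothPow_nonneg (hM : 0 ≤ M) (η r : ℝ) : 0 ≤ smoothPow α M η r :=
  mul_nonneg hM (Real.rpow_nonneg (smoothNorm_nonneg _ _) _)

end SmoothPow

section Caputo

/-- The Caputo derivative `J[f](t) + K_{(0,t)}[f](t)` of order `α`. -/
def caputo (α : ℝ) (f : ℝ → ℝ) (t : ℝ) : ℝ := caputoJ α f t + caputoK α 0 t f t

/-- The backward increment `f(t) - f(t - τ)`, where `f` is extended to negative times by `f 0`. -/
def increment (f : ℝ → ℝ) (t τ : ℝ) : ℝ := f t - f (t - min τ t)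

/-- The part of the Caputo derivative that looks back further than `ρ`, with `f` extended to
negative times by `f 0`; for `ρ = 0` it is the Caputo derivative, see `caputo_eq_memory_zero`. -/
def memory (α ρ : ℝ) (f : ℝ → ℝ) (t : ℝ) : ℝ :=
  α / Real.Gamma (1 - α) * ∫ τ in Ioi ρ, increment f t τ / τ ^ (α + 1)

variable {α : ℝ} {f : ℝ → ℝ} {t ρ : ℝ}

theorem div_Gamma_one_sub_pos (hα₀ : 0 < α) (hα₁ : α < 1) : 0 < α / Real.Gamma (1 - α) :=
  div_pos hα₀ (Real.Gamma_pos_of_pos (sub_pos.2 hα₁))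

theorem increment_of_le {τ : ℝ} (h : τ ≤ t) : increment f t τ = f t - f (t - τ) := by
  rw [increment, min_eq_left h]

theorem increment_of_ge {τ : ℝ} (h : t ≤ τ) : increment f t τ = f t - f 0 := by
  rw [increment, min_eq_right h, sub_self]

theorem sub_min_mem_Icc {τ : ℝ} (ht : 0 ≤ t) (hτ : 0 ≤ τ) : t - min τ t ∈ Icc 0 t :=
  ⟨sub_nonneg.2 (min_le_right _ _), sub_le_self _ (le_min hτ ht)⟩

theorem integrableOn_Ioc_rpow_neg (hα₁ : α < 1) (hρ : 0 ≤ ρ) :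
    IntegrableOn (fun τ : ℝ => τ ^ (-α)) (Ioc 0 ρ) :=
  (intervalIntegrable_iff_integrableOn_Ioc_of_le hρ).1
    (intervalIntegral.intervalIntegrable_rpow' (by linarith))

theorem setIntegral_Ioc_rpow_neg (hα₁ : α < 1) (hρ : 0 ≤ ρ) :
    ∫ τ in Ioc 0 ρ, τ ^ (-α) = ρ ^ (1 - α) / (1 - α) := by
  rw [← intervalIntegral.integral_of_le hρ, integral_rpow (Or.inl (by linarith)),
    Real.zero_rpow (by linarith), sub_zero, neg_add_eq_sub]

theorem integrableOn_Ioi_rpow_neg_add_one (hα₀ : 0 < α) (hρ : 0 < ρ) :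
    IntegrableOn (fun τ : ℝ => τ ^ (-(α + 1))) (Ioi ρ) :=
  integrableOn_Ioi_rpow_of_lt (by linarith) hρ

theorem setIntegral_Ioi_rpow_neg_add_one (hα₀ : 0 < α) (hρ : 0 < ρ) :
    ∫ τ in Ioi ρ, τ ^ (-(α + 1)) = ρ ^ (-α) / α := by
  rw [integral_Ioi_rpow_of_lt (by linarith) hρ, show -(α + 1) + 1 = -α by ring, neg_div_neg_eq]

theorem div_rpow_add_one {τ : ℝ} (hτ : 0 < τ) (α c : ℝ) :
    c / τ ^ (α + 1) = c * τ ^ (-(α + 1)) := by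
  rw [Real.rpow_neg hτ.le, div_eq_mul_inv]

theorem mul_div_rpow_add_one {τ : ℝ} (hτ : 0 < τ) (α c : ℝ) :
    c * τ / τ ^ (α + 1) = c * τ ^ (-α) := by
  rw [Real.rpow_add_one hτ.ne', mul_div_mul_right _ _ hτ.ne', Real.rpow_neg hτ.le, div_eq_mul_inv]

theorem mul_rpow_div_rpow_add_one {τ : ℝ} (hτ : 0 < τ) (α c : ℝ) :
    c * τ ^ α / τ ^ (α + 1) = c * τ⁻¹ := by
  rw [Real.rpow_add_one hτ.ne', mul_comm (τ ^ α), mul_div_mul_right _ _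
    (Real.rpow_pos_of_pos hτ α).ne', div_eq_mul_inv]

theorem le_setIntegral_Ioc_zero_of_mul_le {F : ℝ → ℝ} {c : ℝ} (hα₁ : α < 1) (hρ : 0 ≤ ρ)
    (hint : IntegrableOn (fun τ => F τ / τ ^ (α + 1)) (Ioc 0 ρ))
    (hF : ∀ τ ∈ Ioc 0 ρ, c * τ ≤ F τ) :
    c * (ρ ^ (1 - α) / (1 - α)) ≤ ∫ τ in Ioc 0 ρ, F τ / τ ^ (α + 1) := by
  rw [← setIntegral_Ioc_rpow_neg hα₁ hρ, ← integral_const_mul]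
  refine setIntegral_mono_on ((integrableOn_Ioc_rpow_neg hα₁ hρ).const_mul _) hint
    measurableSet_Ioc fun τ hτ => ?_
  rw [← mul_div_rpow_add_one hτ.1]
  exact div_le_div_of_nonneg_right (hF τ hτ) (Real.rpow_nonneg hτ.1.le _)

theorem le_setIntegral_Ioi_of_le {F : ℝ → ℝ} {c : ℝ} (hα₀ : 0 < α) (hρ : 0 < ρ)
    (hint : IntegrableOn (fun τ => F τ / τ ^ (α + 1)) (Ioi ρ)) (hF : ∀ τ ∈ Ioi ρ, c ≤ F τ) :
    c * (ρ ^ (-α) / α) ≤ ∫ τ in Ioi ρ, F τ / τ ^ (α + 1) := by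
  rw [← setIntegral_Ioi_rpow_neg_add_one hα₀ hρ, ← integral_const_mul]
  refine setIntegral_mono_on ((integrableOn_Ioi_rpow_neg_add_one hα₀ hρ).const_mul _) hint
    measurableSet_Ioi fun τ hτ => ?_
  have hτ₀ : 0 < τ := hρ.trans hτ
  rw [← div_rpow_add_one hτ₀]
  exact div_le_div_of_nonneg_right (hF τ hτ) (Real.rpow_nonneg hτ₀.le _)

theorem le_setIntegral_Ioc_of_mul_rpow_le {F : ℝ → ℝ} {a b c : ℝ} (ha : 0 < a) (hab : a ≤ b)
    (hint : IntegrableOn (fun τ => F τ / τ ^ (α + 1)) (Ioc a b))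
    (hF : ∀ τ ∈ Ioc a b, c * τ ^ α ≤ F τ) :
    c * Real.log (b / a) ≤ ∫ τ in Ioc a b, F τ / τ ^ (α + 1) := by
  have hinv : IntegrableOn (fun τ : ℝ => τ⁻¹) (Ioc a b) :=
    (ContinuousOn.inv₀ continuousOn_id fun τ hτ => (ha.trans_le hτ.1).ne').integrableOn_Icc.mono_set
      Ioc_subset_Icc_self
  rw [← integral_inv_of_pos ha (ha.trans_le hab), intervalIntegral.integral_of_le hab,
    ← integral_const_mul]
  refine setIntegral_mono_on (hinv.const_mul c) hint measurableSet_Ioc fun τ hτ => ?_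
  have hτ₀ : 0 < τ := ha.trans hτ.1
  rw [← mul_rpow_div_rpow_add_one hτ₀]
  exact div_le_div_of_nonneg_right (hF τ hτ) (Real.rpow_nonneg hτ₀.le _)

theorem setIntegral_Ioc_add_Ioi {F : ℝ → ℝ} {a b : ℝ} (hab : a ≤ b) (hF : IntegrableOn F (Ioi a)) :
    (∫ τ in Ioc a b, F τ) + ∫ τ in Ioi b, F τ = ∫ τ in Ioi a, F τ := by
  rw [← intervalIntegral.integral_of_le hab]
  exact intervalIntegral.integral_interval_add_Ioi hF (hF.mono_set (Ioi_subset_Ioi hab))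

theorem continuousOn_increment_div (ht : 0 ≤ t) (hf : ContinuousOn f (Icc 0 t)) :
    ContinuousOn (fun τ => increment f t τ / τ ^ (α + 1)) (Ioi 0) := by
  refine ContinuousOn.div ?_ ?_ fun τ hτ => (Real.rpow_pos_of_pos hτ _).ne'
  · exact continuousOn_const.sub
      (hf.comp (by fun_prop) fun τ hτ => sub_min_mem_Icc ht (le_of_lt hτ))
  · exact continuousOn_id.rpow_const fun τ hτ => Or.inl (ne_of_gt hτ)

theorem integrableOn_increment_div (hα₀ : 0 < α) (ht : 0 ≤ t) (hρ : 0 < ρ)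
    (hf : ContinuousOn f (Icc 0 t)) :
    IntegrableOn (fun τ => increment f t τ / τ ^ (α + 1)) (Ioi ρ) := by
  obtain ⟨B, hB⟩ := isCompact_Icc.exists_bound_of_continuousOn hf
  refine Integrable.mono' ((integrableOn_Ioi_rpow_neg_add_one hα₀ hρ).const_mul (2 * B))
    (((continuousOn_increment_div ht hf).mono (Ioi_subset_Ioi hρ.le)).aestronglyMeasurable
      measurableSet_Ioi) ?_
  filter_upwards [ae_restrict_mem measurableSet_Ioi] with τ hτ
  have hτ₀ : 0 < τ := hρ.trans hτ
  rw [norm_div, Real.norm_of_nonneg (Real.rpow_nonneg hτ₀.le _), ← div_rpow_add_one hτ₀]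
  gcongr
  calc ‖increment f t τ‖ ≤ ‖f t‖ + ‖f (t - min τ t)‖ := norm_sub_le _ _
    _ ≤ 2 * B := by linarith [hB t ⟨ht, le_rfl⟩, hB _ (sub_min_mem_Icc ht hτ₀.le)]

theorem integrableOn_increment_div_of_lipschitz (hα₀ : 0 < α) (hα₁ : α < 1) (ht : 0 ≤ t) {G : ℝ}
    (hf : ContinuousOn f (Icc 0 t)) (hG : ∀ τ, 0 < τ → |increment f t τ| ≤ G * τ) :
    IntegrableOn (fun τ => increment f t τ / τ ^ (α + 1)) (Ioi 0) := by
  rw [← Ioc_union_Ioi_eq_Ioi zero_le_one]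
  refine IntegrableOn.union ?_ (integrableOn_increment_div hα₀ ht one_pos hf)
  refine Integrable.mono' ((integrableOn_Ioc_rpow_neg hα₁ zero_le_one).const_mul G)
    (((continuousOn_increment_div ht hf).mono Ioc_subset_Ioi_self).aestronglyMeasurable
      measurableSet_Ioc) ?_
  filter_upwards [ae_restrict_mem measurableSet_Ioc] with τ hτ
  rw [norm_div, Real.norm_of_nonneg (Real.rpow_nonneg hτ.1.le _), ← mul_div_rpow_add_one hτ.1]
  exact div_le_div_of_nonneg_right (hG τ hτ.1) (Real.rpow_nonneg hτ.1.le _)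

theorem exists_abs_increment_le (hf : ContDiff ℝ 1 f) (ht : 0 ≤ t) :
    ∃ G : ℝ, ∀ τ, 0 < τ → |increment f t τ| ≤ G * τ := by
  obtain ⟨K, hK⟩ := hf.contDiffOn.exists_lipschitzOnWith one_ne_zero (convex_Icc 0 t) isCompact_Icc
  refine ⟨K, fun τ hτ => ?_⟩
  have h := hK.dist_le_mul t ⟨ht, le_rfl⟩ _ (sub_min_mem_Icc ht hτ.le)
  rw [Real.dist_eq, Real.dist_eq, sub_sub_cancel, abs_of_nonneg (le_min hτ.le ht)] at h
  exact h.trans (mul_le_mul_of_nonneg_left (min_le_left _ _) K.2)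

theorem caputo_eq_memory_zero (hα₀ : 0 < α) (ht : 0 < t)
    (hint : IntegrableOn (fun τ => increment f t τ / τ ^ (α + 1)) (Ioi 0)) :
    caputo α f t = memory α 0 f t := by
  have hrecent : ∫ τ in Ioc 0 t, increment f t τ / τ ^ (α + 1)
      = ∫ τ in 0..t, (f t - f (t - τ)) / τ ^ (α + 1) := by
    rw [intervalIntegral.integral_of_le ht.le]
    refine setIntegral_congr_fun measurableSet_Ioc fun τ hτ => ?_
    simp only [increment_of_le hτ.2]
  have hinitial : ∫ τ in Ioi t, increment f t τ / τ ^ (α + 1) = (f t - f 0) * (t ^ (-α) / α) := by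
    rw [← setIntegral_Ioi_rpow_neg_add_one hα₀ ht, ← integral_const_mul]
    refine setIntegral_congr_fun measurableSet_Ioi fun τ hτ => ?_
    simp only [increment_of_ge (le_of_lt hτ), div_rpow_add_one (ht.trans hτ)]
  rw [memory, ← setIntegral_Ioc_add_Ioi ht.le hint, hrecent, hinitial, caputo, caputoJ, caputoK,
    Real.rpow_neg ht.le]
  have := (Real.rpow_pos_of_pos ht α).ne'
  field_simp
  ring

section RegularisedHolder

variable {M : ℝ}

theorem neg_div_le_setIntegral_Ioc_increment {η : ℝ} (hα₁ : α < 1) (hη : 0 < η)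
    (hint : IntegrableOn (fun τ => increment f t τ / τ ^ (α + 1)) (Ioc 0 η))
    (hLip : ∀ τ, 0 < τ → |increment f t τ| ≤ M * η ^ (α - 1) * τ) :
    -(M / (1 - α)) ≤ ∫ τ in Ioc 0 η, increment f t τ / τ ^ (α + 1) := by
  have hone : η ^ (α - 1) * η ^ (1 - α) = 1 := by
    rw [← Real.rpow_add hη, sub_add_sub_cancel', sub_self, Real.rpow_zero]
  calc -(M / (1 - α)) = -(M * η ^ (α - 1)) * (η ^ (1 - α) / (1 - α)) := by
        linear_combination M / (1 - α) * hone
    _ ≤ _ := le_setIntegral_Ioc_zero_of_mul_le hα₁ hη.le hint fun τ hτ => by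
        linarith [(abs_le.1 (hLip τ hτ.1)).1]

theorem neg_mul_log_le_setIntegral_Ioc_increment {a b : ℝ} (ha : 0 < a) (hab : a ≤ b)
    (hint : IntegrableOn (fun τ => increment f t τ / τ ^ (α + 1)) (Ioc a b))
    (hHol : ∀ τ, 0 < τ → |increment f t τ| ≤ M * τ ^ α) :
    -(M * Real.log (b / a)) ≤ ∫ τ in Ioc a b, increment f t τ / τ ^ (α + 1) := by
  rw [← neg_mul]
  refine le_setIntegral_Ioc_of_mul_rpow_le ha hab hint fun τ hτ => ?_
  linarith [(abs_le.1 (hHol τ (ha.trans hτ.1))).1]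

theorem neg_div_le_setIntegral_Ioi_increment {T : ℝ} (hα₀ : 0 < α) (hT : 0 < T)
    (hint : IntegrableOn (fun τ => increment f t τ / τ ^ (α + 1)) (Ioi T))
    (hbound : ∀ τ, 0 < τ → |increment f t τ| ≤ M * T ^ α) :
    -(M / α) ≤ ∫ τ in Ioi T, increment f t τ / τ ^ (α + 1) := by
  have hone : T ^ α * T ^ (-α) = 1 := by rw [← Real.rpow_add hT, add_neg_cancel, Real.rpow_zero]
  calc -(M / α) = -(M * T ^ α) * (T ^ (-α) / α) := by linear_combination M / α * hone
    _ ≤ _ := le_setIntegral_Ioi_of_le hα₀ hT hint fun τ hτ =>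
        (abs_le.1 (hbound τ (hT.trans hτ))).1

theorem neg_log_le_caputo {η T : ℝ} (hα₀ : 0 < α) (hα₁ : α < 1) (hη₀ : 0 < η)
    (hηT : η ≤ T) (ht : t ∈ Ioc 0 T) (hf : ContinuousOn f (Icc 0 t)) (hM : 0 ≤ M)
    (hLip : ∀ τ, 0 < τ → |increment f t τ| ≤ M * η ^ (α - 1) * τ)
    (hHol : ∀ τ, 0 < τ → |increment f t τ| ≤ M * min τ t ^ α) :
    -(α / Real.Gamma (1 - α) * (M / (1 - α) + M * Real.log (T / η) + M / α)) ≤ caputo α f t := by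
  have hT₀ : 0 < T := hη₀.trans_le hηT
  have hHol' : ∀ b τ, 0 < τ → min τ t ≤ b → |increment f t τ| ≤ M * b ^ α := fun b τ hτ hb =>
    (hHol τ hτ).trans
      (mul_le_mul_of_nonneg_left (Real.rpow_le_rpow (le_min hτ.le ht.1.le) hb hα₀.le) hM)
  have hint := integrableOn_increment_div_of_lipschitz hα₀ hα₁ ht.1.le hf hLip
  have hintη := hint.mono_set (Ioi_subset_Ioi hη₀.le)
  have hrecent := neg_div_le_setIntegral_Ioc_increment hα₁ hη₀
    (hint.mono_set Ioc_subset_Ioi_self) hLip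
  have hmiddle := neg_mul_log_le_setIntegral_Ioc_increment hη₀ hηT
    (hintη.mono_set Ioc_subset_Ioi_self) fun τ hτ => hHol' τ τ hτ (min_le_left _ _)
  have hinitial := neg_div_le_setIntegral_Ioi_increment hα₀ hT₀
    (hintη.mono_set (Ioi_subset_Ioi hηT)) fun τ hτ => hHol' T τ hτ ((min_le_right _ _).trans ht.2)
  rw [caputo_eq_memory_zero hα₀ ht.1 hint, memory, ← setIntegral_Ioc_add_Ioi hη₀.le hint,
    ← setIntegral_Ioc_add_Ioi hηT hintη, ← mul_neg]
  refine mul_le_mul_of_nonneg_left ?_ (div_Gamma_one_sub_pos hα₀ hα₁).le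
  linarith

end RegularisedHolder

end Caputo

section CaputoBounds

variable {α : ℝ} {f v : ℝ → ℝ} {t s ρ : ℝ}

theorem exists_neg_log_le_caputo_smoothPow {M : ℝ} (T : ℝ) (hα₀ : 0 < α) (hα₁ : α < 1)
    (hM : 0 ≤ M) :
    ∃ A : ℝ, 0 ≤ A ∧ ∀ η s t : ℝ, 0 < η → η ≤ 1 → t ∈ Ioc 0 T →
      -(A * (1 + Real.log (1 / η))) ≤ caputo α (fun r => smoothPow α M η (r - s)) t := by
  have := one_div_nonneg.2 (sub_nonneg.2 hα₁.le)
  have hΓ := (div_Gamma_one_sub_pos hα₀ hα₁).le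
  set γ := α / Real.Gamma (1 - α)
  set T' := max T 1
  have hT' : 1 ≤ T' := le_max_right _ _
  have hlogT : 0 ≤ Real.log T' := Real.log_nonneg hT'
  set c := 1 / (1 - α) + Real.log T' + 1 / α with hc
  have : 0 ≤ c := by positivity
  refine ⟨γ * (M * (c + 1)), by positivity, fun η s t hη₀ hη₁ ht => ?_⟩
  have hlag : ∀ τ, 0 < τ → |t - s - (t - min τ t - s)| = min τ t := fun τ hτ => by
    rw [sub_sub_sub_cancel_right, sub_sub_cancel, abs_of_nonneg (le_min hτ.le ht.1.le)]
  have hLip : ∀ τ, 0 < τ →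
      |increment (fun r => smoothPow α M η (r - s)) t τ| ≤ M * η ^ (α - 1) * τ := fun τ hτ => by
    refine (abs_smoothPow_sub_le_mul hα₀.le hα₁.le hM hη₀ (t - s) (t - min τ t - s)).trans ?_
    rw [hlag τ hτ]
    gcongr
    exact min_le_left _ _
  have hHol : ∀ τ, 0 < τ →
      |increment (fun r => smoothPow α M η (r - s)) t τ| ≤ M * min τ t ^ α := fun τ hτ => by
    rw [← hlag τ hτ]
    exact abs_smoothPow_sub_le_rpow hα₀.le hα₁.le hM η (t - s) (t - min τ t - s)
  have hlog : 0 ≤ Real.log (1 / η) := Real.log_nonneg (by rwa [le_div_iff₀ hη₀, one_mul])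
  have hlogdiv : Real.log (T' / η) = Real.log T' + Real.log (1 / η) := by
    rw [← Real.log_mul (by positivity) (by positivity), mul_one_div]
  calc -(γ * (M * (c + 1)) * (1 + Real.log (1 / η)))
      = -(γ * (M / (1 - α) + M * Real.log (T' / η) + M / α)) -
          γ * (M * (1 + c * Real.log (1 / η))) := by
        rw [hlogdiv, hc]
        ring
    _ ≤ -(γ * (M / (1 - α) + M * Real.log (T' / η) + M / α)) := sub_le_self _ (by positivity)
    _ ≤ caputo α (fun r => smoothPow α M η (r - s)) t :=
        neg_log_le_caputo hα₀ hα₁ hη₀ (hη₁.trans hT') ⟨ht.1, ht.2.trans (le_max_left _ _)⟩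
          ((contDiff_smoothPow α M hη₀).continuous.comp (continuous_sub_right s)).continuousOn
          hM hLip hHol

theorem caputo_neg (α : ℝ) (f : ℝ → ℝ) (t : ℝ) : caputo α (fun s => -f s) t = -caputo α f t := by
  have h : ∀ τ : ℝ, (-f t - -f (t - τ)) / τ ^ (α + 1) = -((f t - f (t - τ)) / τ ^ (α + 1)) :=
    fun τ => by ring
  simp only [caputo, caputoJ, caputoK, h, intervalIntegral.integral_neg]
  ring

theorem memory_neg (α ρ : ℝ) (f : ℝ → ℝ) (t : ℝ) :
    memory α ρ (fun s => -f s) t = -memory α ρ f t := by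
  have h : ∀ τ, increment (fun s => -f s) t τ / τ ^ (α + 1) = -(increment f t τ / τ ^ (α + 1)) :=
    fun τ => by simp only [increment]; ring
  simp only [memory, h, integral_neg, mul_neg]

theorem div_Gamma_le_caputo_rpow {C : ℝ} (hα₀ : 0 < α) (hα₁ : α < 1) (hC : 0 ≤ C) (ht : 0 < t) :
    C / Real.Gamma (1 - α) ≤ caputo α (fun s => C * s ^ α) t := by
  have hJ : caputoJ α (fun s => C * s ^ α) t = C / Real.Gamma (1 - α) := by
    have := (Real.rpow_pos_of_pos ht α).ne'
    simp only [caputoJ, Real.zero_rpow hα₀.ne']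
    field_simp
    ring
  have hK : 0 ≤ caputoK α 0 t (fun s => C * s ^ α) t := by
    refine mul_nonneg (div_Gamma_one_sub_pos hα₀ hα₁).le
      (intervalIntegral.integral_nonneg ht.le fun τ hτ =>
        div_nonneg (sub_nonneg.2 ?_) (Real.rpow_nonneg hτ.1 _))
    exact mul_le_mul_of_nonneg_left
      (Real.rpow_le_rpow (sub_nonneg.2 hτ.2) (sub_le_self t hτ.1) hα₀.le) hC
  rw [caputo, hJ]
  exact le_add_of_nonneg_right hK

theorem memory_sub_le_caputo {G e : ℝ} (hα₀ : 0 < α) (hα₁ : α < 1) (hρ : 0 < ρ) (ht : 0 < t)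
    (hf : IntegrableOn (fun τ => increment f t τ / τ ^ (α + 1)) (Ioi 0))
    (hv : ContinuousOn v (Icc 0 t))
    (hrecent : ∀ τ ∈ Ioc 0 ρ, -G * τ ≤ increment f t τ)
    (hpast : ∀ τ ∈ Ioi ρ, increment v t τ - e ≤ increment f t τ) :
    memory α ρ v t - α / Real.Gamma (1 - α) * (G * (ρ ^ (1 - α) / (1 - α)) + e * (ρ ^ (-α) / α))
      ≤ caputo α f t := by
  have hf' := hf.mono_set (Ioi_subset_Ioi hρ.le)
  have hv' := integrableOn_increment_div hα₀ ht.le hρ hv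
  have h₁ := le_setIntegral_Ioc_zero_of_mul_le hα₁ hρ.le (hf.mono_set Ioc_subset_Ioi_self) hrecent
  have h₂ : -e * (ρ ^ (-α) / α) ≤
      ∫ τ in Ioi ρ, (increment f t τ - increment v t τ) / τ ^ (α + 1) := by
    refine le_setIntegral_Ioi_of_le hα₀ hρ ?_ fun τ hτ => by linarith [hpast τ hτ]
    simp only [sub_div]
    exact hf'.sub hv'
  simp only [sub_div, integral_sub hf' hv'] at h₂
  rw [caputo_eq_memory_zero hα₀ ht hf, memory, memory, ← setIntegral_Ioc_add_Ioi hρ.le hf,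
    ← mul_sub]
  refine mul_le_mul_of_nonneg_left ?_ (div_Gamma_one_sub_pos hα₀ hα₁).le
  linarith

theorem le_memory_sub_memory {T θ : ℝ} (hα₀ : 0 < α) (hα₁ : α < 1) (ht : t ∈ Icc 0 T)
    (hs : s ∈ Icc 0 T) (hρ : 0 < ρ) (hρT : ρ ≤ T)
    (hf : ContinuousOn f (Icc 0 t)) (hv : ContinuousOn v (Icc 0 s))
    (hle : ∀ τ, 0 < τ → increment v s τ ≤ increment f t τ)
    (hθ : θ ≤ (f t - f 0) - (v s - v 0)) :
    α / Real.Gamma (1 - α) * (θ * (T ^ (-α) / α)) ≤ memory α ρ f t - memory α ρ v s := by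
  have hf' := integrableOn_increment_div hα₀ ht.1 hρ hf
  have hv' := integrableOn_increment_div hα₀ hs.1 hρ hv
  have hint : IntegrableOn (fun τ => (increment f t τ - increment v s τ) / τ ^ (α + 1))
      (Ioi ρ) := by
    simp only [sub_div]
    exact hf'.sub hv'
  have hrecent : 0 ≤ ∫ τ in Ioc ρ T, (increment f t τ - increment v s τ) / τ ^ (α + 1) :=
    setIntegral_nonneg measurableSet_Ioc fun τ hτ =>
      have hτ₀ := hρ.trans hτ.1
      div_nonneg (sub_nonneg.2 (hle τ hτ₀)) (Real.rpow_nonneg hτ₀.le _)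
  have hpast : θ * (T ^ (-α) / α) ≤
      ∫ τ in Ioi T, (increment f t τ - increment v s τ) / τ ^ (α + 1) :=
    le_setIntegral_Ioi_of_le hα₀ (hρ.trans_le hρT) (hint.mono_set (Ioi_subset_Ioi hρT))
      fun τ hτ => by
        rwa [increment_of_ge (ht.2.trans (le_of_lt hτ)), increment_of_ge (hs.2.trans (le_of_lt hτ))]
  have hsplit := setIntegral_Ioc_add_Ioi hρT hint
  simp only [sub_div, integral_sub hf' hv'] at hsplit hrecent hpast
  rw [memory, memory, ← mul_sub]
  refine mul_le_mul_of_nonneg_left ?_ (div_Gamma_one_sub_pos hα₀ hα₁).le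
  linarith

end CaputoBounds

theorem exists_isMaxOn_of_norm_le {E : Type*} [NormedAddCommGroup E] [ProperSpace E]
    {f : E → ℝ} {D : Set E} (hf : ContinuousOn f D) (hD : IsClosed D) {z₀ : E} (hz₀ : z₀ ∈ D)
    {R : ℝ} (hR : ∀ z ∈ D, f z₀ ≤ f z → ‖z‖ ≤ R) : ∃ z ∈ D, IsMaxOn f D z := by
  refine hf.exists_isMaxOn' hD hz₀ (eventually_inf_principal.2 ?_)
  filter_upwards [(isCompact_closedBall (0 : E) R).compl_mem_cocompact] with z hz hzD
  by_contra! hlt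
  exact hz (mem_closedBall_zero_iff.2 (hR z hzD hlt.le))

theorem isClosed_closedDomain (N : ℕ) (T : ℝ) : IsClosed (closedDomain N T) :=
  isClosed_univ.prod isClosed_Icc

section Viscosity

variable {T α ε : ℝ} {H : Space N → Space N → ℝ} {u₀ : Space N → ℝ} {u : Space N → ℝ → ℝ}
  {ψ : Space N → ℝ} {g : ℝ → ℝ}

theorem continuousOn_section (hu : ContinuousOn (Function.uncurry u) (closedDomain N T))
    (x : Space N) {t : ℝ} (ht : t ≤ T) : ContinuousOn (u x) (Icc 0 t) :=
  hu.comp (Continuous.prodMk_right x).continuousOn fun _ hs => ⟨mem_univ _, hs.1, hs.2.trans ht⟩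

theorem exists_max_separable (hT : 0 ≤ T)
    (hu : ContinuousOn (Function.uncurry u) (closedDomain N T)) (hb : IsBounded T u)
    (hψ : Continuous ψ) (hg : ContinuousOn g (Icc 0 T))
    {a : Space N} {c : ℝ} (hc : 0 < c) (hcoer : ∀ x, c * ‖x - a‖ ≤ ψ x) :
    ∃ x, ∃ t ∈ Icc 0 T, ∀ y, ∀ s ∈ Icc 0 T, u y s - ψ y - g s ≤ u x t - ψ x - g t := by
  obtain ⟨B, hB⟩ := hb
  obtain ⟨G, hG⟩ := isCompact_Icc.exists_bound_of_continuousOn hg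
  have hcont : ContinuousOn (fun z : Space N × ℝ => u z.1 z.2 - ψ z.1 - g z.2)
      (closedDomain N T) :=
    (hu.sub (hψ.comp continuous_fst).continuousOn).sub
      (hg.comp continuous_snd.continuousOn fun z hz => hz.2)
  set R := (B + G - (u a 0 - ψ a - g 0)) / c
  obtain ⟨⟨x, t⟩, hxt, hmax⟩ := exists_isMaxOn_of_norm_le hcont (isClosed_closedDomain N T)
    (z₀ := (a, 0)) ⟨mem_univ _, le_rfl, hT⟩ (R := max (‖a‖ + R) T) fun ⟨y, s⟩ hys hle => by
      have hR : ‖y - a‖ ≤ R := by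
        rw [le_div_iff₀ hc]
        linarith [(abs_le.1 (hB y s hys.2)).2, (abs_le.1 (hG s hys.2)).1, hcoer y]
      refine max_le_max ((norm_le_norm_add_norm_sub' y a).trans (by gcongr)) ?_
      rw [Real.norm_of_nonneg hys.2.1]
      exact hys.2.2
  exact ⟨x, t, hxt.2, fun y s hs => hmax (show (y, s) ∈ closedDomain N T from ⟨mem_univ _, hs⟩)⟩

theorem gradient_fun_neg (f : Space N → ℝ) (x : Space N) :
    gradient (fun z => -f z) x = -gradient f x := by
  rw [gradient, fderiv_fun_neg, map_neg, gradient]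

theorem IsSupersolution.neg (h : IsSupersolution T α ε H u₀ u) :
    IsSubsolution T α ε (fun x p => -H x (-p)) (fun x => -u₀ x) (fun x t => -u x t) := by
  refine ⟨fun z hz y hy => ?_, fun x => neg_le_neg (h.2.1 x), fun φ hφ x t ht hmax => ?_⟩
  · exact (h.1 z hz (-y) (neg_lt.1 hy)).mono fun w hw => neg_lt.1 hw
  · have hmin := h.2.2 (fun x t => -φ x t) ⟨hφ.1.neg, hφ.2.neg⟩ x t ht fun z hz => by
      have := hmax hz
      simp only [mem_ofPred_eq] at this ⊢
      linarith
    have hcaputo := caputo_neg α (φ x) t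
    simp only [caputo] at hcaputo
    simp only [operator, hcaputo, gradient_fun_neg] at hmin ⊢
    linarith

theorem isTestFunction_separable (hψ : ContDiff ℝ 1 ψ) (hg : ContDiffOn ℝ 1 g (Ioc 0 T))
    (hg' : ContinuousOn g (Icc 0 T)) : IsTestFunction T (fun x t => ψ x + g t) :=
  ⟨(hψ.comp contDiff_fst).contDiffOn.add (hg.comp contDiff_snd.contDiffOn fun _ hz => hz.2),
    (hψ.continuous.comp continuous_fst).continuousOn.add
      (hg'.comp continuous_snd.continuousOn fun _ hz => hz.2)⟩

theorem operator_separable (α ε : ℝ) (H : Space N → Space N → ℝ) (g : ℝ → ℝ) {x p : Space N}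
    (hp : HasGradientAt ψ p x) (t : ℝ) :
    operator α ε H (fun x t => ψ x + g t) x t = caputo α g t + H (ε⁻¹ • x) p := by
  have hgrad : gradient (fun z => ψ z + g t) x = p :=
    HasGradientAt.gradient (hasGradientAt_iff_hasFDerivAt.2 (hp.hasFDerivAt.add_const (g t)))
  rw [operator, hgrad]
  simp only [caputo, caputoJ, caputoK, add_sub_add_left_eq_sub]

theorem IsSubsolution.caputo_add_le (h : IsSubsolution T α ε H u₀ u) (hψ : ContDiff ℝ 1 ψ)
    (hg : ContDiffOn ℝ 1 g (Ioc 0 T)) (hg' : ContinuousOn g (Icc 0 T)) {x p : Space N}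
    (hp : HasGradientAt ψ p x) {t : ℝ} (ht : t ∈ Ioc 0 T)
    (hmax : ∀ y, ∀ s ∈ Icc 0 T, u y s - ψ y - g s ≤ u x t - ψ x - g t) :
    caputo α g t + H (ε⁻¹ • x) p ≤ 0 := by
  rw [← operator_separable α ε H g hp t]
  refine h.2.2 _ (isTestFunction_separable hψ hg hg') x t ht fun z hz => ?_
  have := hmax z.1 z.2 hz.2
  simp only [mem_ofPred_eq]
  linarith

theorem IsSubsolution.le_add_mul_rpow (hT : 0 ≤ T) (hα₀ : 0 < α) (hα₁ : α < 1)
    (h : IsSubsolution T α ε H u₀ u)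
    (hu : ContinuousOn (Function.uncurry u) (closedDomain N T)) (hb : IsBounded T u)
    {L A C : ℝ} (hL : 0 < L) (hLip : ∀ x y, u₀ x - u₀ y ≤ L * ‖x - y‖)
    (hA : ∀ x p, ‖p‖ ≤ L → -A ≤ H x p) (hC : 0 ≤ C) (hAC : A < C / Real.Gamma (1 - α))
    (y : Space N) {s : ℝ} (hs : s ∈ Icc 0 T) : u y s ≤ u₀ y + C * s ^ α := by
  refine le_of_forall_pos_le_add fun e he => ?_
  set σ := e / L
  have hσ : 0 < σ := by positivity
  have hψ : ContDiff ℝ 1 fun x => L * smoothNorm σ (x - y) :=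
    contDiff_const.mul ((contDiff_smoothNorm hσ).comp (contDiff_id.sub contDiff_const))
  have hg : ContDiffOn ℝ 1 (fun t => C * t ^ α) (Ioc 0 T) :=
    contDiffOn_const.mul (contDiffOn_id.rpow_const_of_ne fun t ht => ht.1.ne')
  have hg' : Continuous fun t => C * t ^ α :=
    continuous_const.mul (Real.continuous_rpow_const hα₀.le)
  have hcoer : ∀ x, L * ‖x - y‖ ≤ L * smoothNorm σ (x - y) := fun x => by
    gcongr
    exact norm_le_smoothNorm σ (x - y)
  obtain ⟨x, t, ht, hmax⟩ := exists_max_separable hT hu hb hψ.continuous hg'.continuousOn hL hcoer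
  obtain rfl | ht₀ := ht.1.eq_or_lt
  · have hmaxs := hmax y s hs
    have hσy : L * smoothNorm σ (y - y) = e := by
      rw [sub_self, smoothNorm_zero hσ.le, mul_div_cancel₀ e hL.ne']
    rw [hσy, Real.zero_rpow hα₀.ne'] at hmaxs
    linarith [h.2.1 x, hLip x y, hcoer x]
  · have hgrad := hasGradientAt_const_mul (hasGradientAt_smoothNorm_sub hσ y x) L
    have htest := h.caputo_add_le hψ hg hg'.continuousOn hgrad ⟨ht₀, ht.2⟩ hmax
    have hgrad_le : ‖L • ((smoothNorm σ (x - y))⁻¹ • (x - y))‖ ≤ L := by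
      rw [norm_smul, Real.norm_of_nonneg hL.le]
      exact mul_le_of_le_one_right hL.le (norm_smoothNorm_inv_smul_le hσ _)
    linarith [hA (ε⁻¹ • x) _ hgrad_le, div_Gamma_le_caputo_rpow hα₀ hα₁ hC ht₀]

end Viscosity

theorem exists_contDiff_minorant {v : ℝ → ℝ} {T a b e : ℝ} (hv : ContinuousOn v (Icc 0 T))
    (hv₀ : ∀ s ∈ Icc 0 T, 0 ≤ v s) (hab : a < b) (he : 0 < e) :
    ∃ q : ℝ → ℝ, ContDiff ℝ 1 q ∧ (∀ s ∈ Icc 0 T, -e ≤ q s) ∧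
      (∀ s ∈ Icc 0 T, q s ≤ max (v s - e / 3) 0) ∧
      (∀ s ∈ Icc 0 T, s ≤ a → v s - e ≤ q s) ∧ ∀ s, b ≤ s → q s = 0 := by
  obtain ⟨P, hP⟩ := exists_polynomial_near_of_continuousOn 0 T (fun s => v s - 2 * e / 3)
    (hv.sub continuousOn_const) (e / 3) (by positivity)
  have hP_lower : ∀ s ∈ Icc 0 T, v s - e ≤ P.eval s := fun s hs => by
    linarith [(abs_lt.1 (hP s hs)).1]
  have hP_upper : ∀ s ∈ Icc 0 T, P.eval s ≤ v s - e / 3 := fun s hs => by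
    linarith [(abs_lt.1 (hP s hs)).2]
  set χ : ℝ → ℝ := fun s => Real.smoothTransition ((b - s) / (b - a))
  have hχ₀ : ∀ s, 0 ≤ χ s := fun s => Real.smoothTransition.nonneg _
  have hχ₁ : ∀ s, χ s ≤ 1 := fun s => Real.smoothTransition.le_one _
  have hχ : ContDiff ℝ 1 χ :=
    Real.smoothTransition.contDiff.comp ((contDiff_const.sub contDiff_id).div_const _)
  refine ⟨fun s => χ s * P.eval s, hχ.mul (by simpa using P.contDiff_aeval (𝕜 := ℝ) 1),
    fun s hs => ?_, fun s hs => ?_, fun s hs hsa => ?_, fun s hs => ?_⟩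
  · nlinarith [hχ₀ s, hχ₁ s, hP_lower s hs, hv₀ s hs]
  · calc χ s * P.eval s ≤ χ s * max (v s - e / 3) 0 :=
          mul_le_mul_of_nonneg_left ((hP_upper s hs).trans (le_max_left _ _)) (hχ₀ s)
      _ ≤ max (v s - e / 3) 0 := mul_le_of_le_one_left (le_max_right _ _) (hχ₁ s)
  · have : χ s = 1 := Real.smoothTransition.one_of_one_le
      ((one_le_div (sub_pos.2 hab)).2 (sub_le_sub_left hsa b))
    simpa only [this, one_mul] using hP_lower s hs
  · have : χ s = 0 := Real.smoothTransition.zero_of_nonpos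
      (div_nonpos_of_nonpos_of_nonneg (sub_nonpos.2 hs) (sub_pos.2 hab).le)
    simp only [this, zero_mul]

theorem exists_sub_mul_norm_sq_le {T e : ℝ} {w : Space N → ℝ → ℝ} {q : ℝ → ℝ} {x : Space N}
    (hw : ContinuousOn (Function.uncurry w) (closedDomain N T))
    (hw₀ : ∀ y, ∀ s ∈ Icc 0 T, 0 ≤ w y s) (hq : ContinuousOn q (Icc 0 T)) (he : 0 < e)
    (hqw : ∀ s ∈ Icc 0 T, q s ≤ max (w x s - e) 0) :
    ∃ Λ : ℝ, ∀ y, ∀ s ∈ Icc 0 T, q s - Λ * ‖y - x‖ ^ 2 ≤ w y s := by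
  obtain ⟨Q, hQ⟩ := isCompact_Icc.exists_bound_of_continuousOn hq
  have huc : UniformContinuousOn (Function.uncurry w) (Metric.closedBall x 1 ×ˢ Icc 0 T) :=
    ((isCompact_closedBall _ _).prod isCompact_Icc).uniformContinuousOn_of_continuous
      (hw.mono (prod_mono_left (subset_univ _)))
  obtain ⟨d, hd, hwd⟩ := Metric.uniformContinuousOn_iff.1 huc e he
  set r := min d 1
  have : 0 < r := lt_min hd one_pos
  refine ⟨|Q| / r ^ 2, fun y s hs => ?_⟩
  rcases lt_or_ge ‖y - x‖ r with hy | hy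
  · have hdist : dist (y, s) (x, s) < d := by
      rw [Prod.dist_eq, dist_self, max_eq_left dist_nonneg, dist_eq_norm]
      exact hy.trans_le (min_le_left _ _)
    have hclose := hwd (y, s) ⟨mem_closedBall_iff_norm.2 (hy.le.trans (min_le_right _ _)), hs⟩
      (x, s) ⟨Metric.mem_closedBall_self zero_le_one, hs⟩ hdist
    rw [Real.dist_eq] at hclose
    simp only [Function.uncurry] at hclose
    have hwy : max (w x s - e) 0 ≤ w y s :=
      max_le (by linarith [(abs_lt.1 hclose).1]) (hw₀ y s hs)
    have : 0 ≤ |Q| / r ^ 2 * ‖y - x‖ ^ 2 := by positivity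
    linarith [hqw s hs]
  · have hQr : |Q| ≤ |Q| / r ^ 2 * ‖y - x‖ ^ 2 := by
      rw [div_mul_eq_mul_div, le_div_iff₀ (by positivity)]
      gcongr
    linarith [le_abs_self (q s), hQ s hs, Real.norm_eq_abs (q s), le_abs_self Q, hw₀ y s hs]

theorem memory_sub_le_caputo_sub {α G t ρ : ℝ} {v g q : ℝ → ℝ} (hα₀ : 0 < α) (hα₁ : α < 1)
    (hρ : ρ ∈ Ioo 0 t) (hv : ContinuousOn v (Icc 0 t)) (hg : ContDiff ℝ 1 g) (hq : ContDiff ℝ 1 q)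
    (hG : ∀ τ, 0 < τ → |increment g t τ| ≤ G * τ) (hq_lower : ∀ s ∈ Icc 0 t, -(ρ / 2) ≤ q s)
    (hq_past : ∀ s ∈ Icc 0 t, s ≤ t - ρ → (g s - v s) - (g t - v t) - ρ / 2 ≤ q s)
    (hq_recent : ∀ s, t - ρ / 2 ≤ s → q s = 0) :
    memory α ρ v t - α / Real.Gamma (1 - α) * ((G + 1) / (1 - α) + 1 / (2 * α)) * ρ ^ (1 - α)
      ≤ caputo α (fun s => g s - q s) t := by
  obtain ⟨hρ₀, hρt⟩ := hρ
  have ht : 0 < t := hρ₀.trans hρt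
  have hqt : q t = 0 := hq_recent t (by linarith)
  have hgq : ContDiff ℝ 1 (fun s => g s - q s) := hg.sub hq
  obtain ⟨G', hG'⟩ := exists_abs_increment_le hgq ht.le
  have hrecent : ∀ τ ∈ Ioc 0 ρ, -(G + 1) * τ ≤ increment (fun s => g s - q s) t τ := fun τ hτ => by
    have hgτ := (abs_le.1 (hG τ hτ.1)).1
    have hmem := sub_min_mem_Icc ht.le hτ.1.le
    have hmin : min τ t = τ := min_eq_left (hτ.2.trans hρt.le)
    simp only [increment, hmin, hqt] at hmem hgτ ⊢
    have hqτ : -τ ≤ q (t - τ) := by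
      rcases le_or_gt τ (ρ / 2) with hle | hlt
      · rw [hq_recent _ (sub_le_sub_left hle t)]
        linarith [hτ.1]
      · linarith [hq_lower _ hmem]
    linarith
  have hpast : ∀ τ ∈ Ioi ρ,
      increment v t τ - ρ / 2 ≤ increment (fun s => g s - q s) t τ := fun τ hτ => by
    have := hq_past _ (sub_min_mem_Icc ht.le (hρ₀.trans hτ).le)
      (sub_le_sub_left (le_min (le_of_lt hτ) hρt.le) t)
    simp only [increment, hqt]
    linarith
  have hρpow : ρ / 2 * (ρ ^ (-α) / α) = 1 / (2 * α) * ρ ^ (1 - α) := by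
    rw [show 1 - α = -α + 1 by ring, Real.rpow_add_one hρ₀.ne']
    field_simp
  have hcaputo := memory_sub_le_caputo hα₀ hα₁ hρ₀ ht
    (integrableOn_increment_div_of_lipschitz hα₀ hα₁ ht.le hgq.continuous.continuousOn hG')
    hv hrecent hpast
  rw [hρpow] at hcaputo
  linear_combination hcaputo

-- The contact defect `w = ψ + g - u` is minimal at `(x, t)`; subtracting from `g` a smooth minorant
-- of `w(x, ·) - w(x, t)` gives a test function close to `u(x, ·)` before time `t - ρ`.
theorem IsSubsolution.exists_memory_add_le {T α ε : ℝ} {H : Space N → Space N → ℝ}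
    {u₀ : Space N → ℝ} {u : Space N → ℝ → ℝ} {ψ : Space N → ℝ} {g : ℝ → ℝ}
    (hα₀ : 0 < α) (hα₁ : α < 1) (h : IsSubsolution T α ε H u₀ u)
    (hu : ContinuousOn (Function.uncurry u) (closedDomain N T))
    (hψ : ContDiff ℝ 1 ψ) (hg : ContDiff ℝ 1 g)
    {x p : Space N} (hp : HasGradientAt ψ p x) {t : ℝ} (ht : t ∈ Ioc 0 T)
    (hmax : ∀ y, ∀ s ∈ Icc 0 T, u y s - ψ y - g s ≤ u x t - ψ x - g t) :
    ∃ C : ℝ, ∀ ρ ∈ Ioo 0 t, memory α ρ (u x) t + H (ε⁻¹ • x) p ≤ C * ρ ^ (1 - α) := by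
  obtain ⟨G, hG⟩ := exists_abs_increment_le hg ht.1.le
  refine ⟨α / Real.Gamma (1 - α) * ((G + 1) / (1 - α) + 1 / (2 * α)), fun ρ hρ => ?_⟩
  have hρ₀ := hρ.1
  set w : Space N → ℝ → ℝ := fun y s => ψ y + g s - u y s - (ψ x + g t - u x t) with w_def
  have hw : ContinuousOn (Function.uncurry w) (closedDomain N T) :=
    (((hψ.continuous.comp continuous_fst).add
      (hg.continuous.comp continuous_snd)).continuousOn.sub hu).sub continuousOn_const
  have hw₀ : ∀ y, ∀ s ∈ Icc 0 T, 0 ≤ w y s := fun y s hs => by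
    rw [w_def]
    linarith [hmax y s hs]
  obtain ⟨q, hq, hq_lower, hq_upper, hq_past, hq_recent⟩ := exists_contDiff_minorant
    (continuousOn_section hw x le_rfl) (hw₀ x) (by linarith : t - ρ < t - ρ / 2) (half_pos hρ₀)
  obtain ⟨Λ, hΛ⟩ := exists_sub_mul_norm_sq_le hw hw₀ hq.continuous.continuousOn (by positivity)
    hq_upper
  have hgrad : HasGradientAt (fun y => ψ y + Λ * ‖y - x‖ ^ 2) p x := by
    simpa using hasGradientAt_add hp (hasGradientAt_const_mul (hasGradientAt_norm_sq_sub x x) Λ)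
  have hgq : ContDiff ℝ 1 (fun s => g s - q s) := hg.sub hq
  have htest := h.caputo_add_le
    (hψ.add (contDiff_const.mul ((contDiff_id.sub contDiff_const).norm_sq ℝ)))
    hgq.contDiffOn hgq.continuous.continuousOn hgrad ht fun y s hs => by
      have hwq := hΛ y s hs
      simp only [w_def, id, hq_recent t (by linarith), sub_self, norm_zero] at hwq ⊢
      linarith
  have hsub : Icc 0 t ⊆ Icc 0 T := Icc_subset_Icc_right ht.2
  have hmemory := memory_sub_le_caputo_sub hα₀ hα₁ hρ (continuousOn_section hu x ht.2) hg hq hG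
    (fun s hs => hq_lower s (hsub hs)) (fun s hs hsρ => by
      have := hq_past s (hsub hs) hsρ
      simp only [w_def] at this
      linarith) hq_recent
  linarith

theorem mul_sub_sq_le {δ : ℝ} (hδ : 0 < δ) (L z : ℝ) :
    L * z - (2 * δ)⁻¹ * z ^ 2 ≤ L ^ 2 * δ / 2 := by
  have hsq : L ^ 2 * δ / 2 - (L * z - (2 * δ)⁻¹ * z ^ 2) = (2 * δ)⁻¹ * (z - L * δ) ^ 2 := by
    field_simp
    ring
  have : 0 ≤ (2 * δ)⁻¹ * (z - L * δ) ^ 2 := by positivity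
  linarith

theorem abs_sub_min_sub_sub_min_le (t s τ : ℝ) :
    |(t - min τ t) - (s - min τ s)| ≤ |t - s| := by
  have h : ∀ r : ℝ, r - min τ r = max (r - τ) 0 := fun r => by
    rw [← max_sub_sub_left, sub_self]
  rw [h, h]
  simpa using abs_max_sub_max_le_abs (t - τ) (s - τ) 0

theorem exists_mul_rpow_le {α θ : ℝ} (hα : 0 < α) (C : ℝ) (hθ : 0 < θ) :
    ∃ η : ℝ, 0 < η ∧ η ≤ 1 ∧ C * η ^ α ≤ θ := by
  have hlim : Tendsto (fun η : ℝ => C * η ^ α) (𝓝[>] 0) (𝓝 0) := by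
    have := ((Real.continuous_rpow_const hα.le).const_mul C).tendsto 0
    rw [Real.zero_rpow hα.ne', mul_zero] at this
    exact this.mono_left nhdsWithin_le_nhds
  obtain ⟨η, hηθ, hη⟩ := ((hlim.eventually (ge_mem_nhds hθ)).and (Ioc_mem_nhdsGT one_pos)).exists
  exact ⟨η, hη.1, hη.2, hηθ⟩

/-- The functional maximised in the doubling of variables for a subsolution `u` and a supersolution
`v`: times are coupled by `G`, points by the quadratic penalty of strength `(2 * δ)⁻¹`, and the
term `κ * smoothNorm 1 z.1` makes the maximum attained. -/
def doubling (u v : Space N → ℝ → ℝ) (G : ℝ → ℝ) (δ κ : ℝ) (z w : Space N × ℝ) : ℝ :=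
  u z.1 z.2 - v w.1 w.2 - G (z.2 - w.2) - (2 * δ)⁻¹ * ‖z.1 - w.1‖ ^ 2 - κ * smoothNorm 1 z.1

/-- The point `(z, w)` maximises the doubling functional over pairs of points of `ℝ^N × [0, T]`. -/
structure IsMaxDoubling (T : ℝ) (u v : Space N → ℝ → ℝ) (G : ℝ → ℝ) (δ κ : ℝ)
    (z w : Space N × ℝ) : Prop where
  left_mem : z ∈ closedDomain N T
  right_mem : w ∈ closedDomain N T
  le : ∀ z' ∈ closedDomain N T, ∀ w' ∈ closedDomain N T,
    doubling u v G δ κ z' w' ≤ doubling u v G δ κ z w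

section Doubling

variable {T δ κ : ℝ} {u v : Space N → ℝ → ℝ} {G : ℝ → ℝ}

theorem doubling_le (u v : Space N → ℝ → ℝ) (G : ℝ → ℝ) (δ : ℝ) (hκ : 0 ≤ κ)
    (z w : Space N × ℝ) :
    doubling u v G δ κ z w ≤
      u z.1 z.2 - v w.1 w.2 - G (z.2 - w.2) - (2 * δ)⁻¹ * ‖z.1 - w.1‖ ^ 2 - κ * ‖z.1‖ :=
  sub_le_sub_left (mul_le_mul_of_nonneg_left (norm_le_smoothNorm 1 z.1) hκ) _

theorem continuousOn_doubling (hu : ContinuousOn (Function.uncurry u) (closedDomain N T))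
    (hv : ContinuousOn (Function.uncurry v) (closedDomain N T)) (hG : Continuous G) (δ κ : ℝ) :
    ContinuousOn (Function.uncurry (doubling u v G δ κ))
      (closedDomain N T ×ˢ closedDomain N T) := by
  have hsmooth : Continuous (smoothNorm 1 : Space N → ℝ) := (contDiff_smoothNorm one_pos).continuous
  refine ((((hu.comp continuousOn_fst fun _ hz => hz.1).sub
    (hv.comp continuousOn_snd fun _ hz => hz.2)).sub ?_).sub ?_).sub ?_
  all_goals exact Continuous.continuousOn (by fun_prop)

theorem exists_isMaxDoubling (hu : ContinuousOn (Function.uncurry u) (closedDomain N T))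
    (hv : ContinuousOn (Function.uncurry v) (closedDomain N T)) (hbu : IsBounded T u)
    (hbv : IsBounded T v) (hG : Continuous G) (hG₀ : ∀ r, 0 ≤ G r) (hδ : 0 < δ) (hκ : 0 < κ)
    {z₀ w₀ : Space N × ℝ} (hz₀ : z₀ ∈ closedDomain N T) (hw₀ : w₀ ∈ closedDomain N T)
    (h₀ : 0 ≤ doubling u v G δ κ z₀ w₀) :
    ∃ z w, IsMaxDoubling T u v G δ κ z w := by
  obtain ⟨B, hB⟩ := hbu
  obtain ⟨B', hB'⟩ := hbv
  set r := (B + B') / κ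
  set r' := 2 * δ * (B + B') + 1
  have hbound : ∀ z ∈ closedDomain N T, ∀ w ∈ closedDomain N T, 0 ≤ doubling u v G δ κ z w →
      ‖z.1‖ ≤ r ∧ ‖z.1 - w.1‖ ≤ r' := fun z hz w hw h => by
    have hle := doubling_le u v G δ hκ.le z w
    have hGzw := hG₀ (z.2 - w.2)
    have hBz := (abs_le.1 (hB z.1 z.2 hz.2)).2
    have hBw := (abs_le.1 (hB' w.1 w.2 hw.2)).1
    have hz_nonneg : 0 ≤ κ * ‖z.1‖ := by positivity
    have hzw_nonneg : 0 ≤ (2 * δ)⁻¹ * ‖z.1 - w.1‖ ^ 2 := by positivity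
    constructor
    · rw [le_div_iff₀' hκ]
      linarith
    · have hsq : ‖z.1 - w.1‖ ^ 2 ≤ 2 * δ * (B + B') := by
        rw [← inv_mul_le_iff₀ (by positivity)]
        linarith
      nlinarith [sq_nonneg (‖z.1 - w.1‖ - 1)]
  obtain ⟨⟨z, w⟩, hzw, hmax⟩ := exists_isMaxOn_of_norm_le (continuousOn_doubling hu hv hG δ κ)
    ((isClosed_closedDomain N T).prod (isClosed_closedDomain N T)) (z₀ := (z₀, w₀)) ⟨hz₀, hw₀⟩
    (R := max (max r T) (max (r + r') T)) fun ⟨z, w⟩ ⟨hz, hw⟩ hle => by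
      obtain ⟨hzr, hzwr⟩ := hbound z hz w hw (h₀.trans hle)
      have htime : ∀ y ∈ closedDomain N T, ‖y.2‖ ≤ T := fun y hy =>
        (Real.norm_of_nonneg hy.2.1).trans_le hy.2.2
      exact max_le_max (max_le_max hzr (htime z hz))
        (max_le_max ((norm_le_norm_add_norm_sub z.1 w.1).trans (add_le_add hzr hzwr)) (htime w hw))
  exact ⟨z, w, hzw.1, hzw.2, fun z' hz' w' hw' => hmax (mk_mem_prod hz' hw')⟩

end Doubling

theorem hasGradientAt_quadratic (δ : ℝ) (a x : Space N) :
    HasGradientAt (fun z => (2 * δ)⁻¹ * ‖z - a‖ ^ 2) (δ⁻¹ • (x - a)) x := by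
  have hδ : (2 * δ)⁻¹ * 2 = δ⁻¹ := by rw [mul_inv_rev, inv_mul_cancel_right₀ two_ne_zero]
  have h := hasGradientAt_const_mul (hasGradientAt_norm_sq_sub a x) (2 * δ)⁻¹
  rwa [smul_smul, hδ] at h

theorem contDiff_quadratic (δ : ℝ) (a : Space N) :
    ContDiff ℝ 1 fun z => (2 * δ)⁻¹ * ‖z - a‖ ^ 2 :=
  contDiff_const.mul ((contDiff_id.sub contDiff_const).norm_sq ℝ)

theorem hasGradientAt_quadratic_add_smoothNorm (δ κ : ℝ) (a x : Space N) :
    HasGradientAt (fun z => (2 * δ)⁻¹ * ‖z - a‖ ^ 2 + κ * smoothNorm 1 z)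
      (δ⁻¹ • (x - a) + κ • ((smoothNorm 1 x)⁻¹ • x)) x := by
  refine hasGradientAt_add (hasGradientAt_quadratic δ a x) (hasGradientAt_const_mul ?_ κ)
  simpa only [sub_zero] using hasGradientAt_smoothNorm_sub one_pos 0 x

theorem contDiff_quadratic_add_smoothNorm (δ κ : ℝ) (a : Space N) :
    ContDiff ℝ 1 fun z => (2 * δ)⁻¹ * ‖z - a‖ ^ 2 + κ * smoothNorm 1 z :=
  (contDiff_quadratic δ a).add (contDiff_const.mul (contDiff_smoothNorm one_pos))

section DoublingMax

variable {T α ε δ κ θ L C : ℝ} {H : Space N → Space N → ℝ} {u₀ : Space N → ℝ}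
  {u v : Space N → ℝ → ℝ} {G : ℝ → ℝ} {z w : Space N × ℝ}

theorem doubling_le_of_time_eq_zero (hα : 0 < α) (hκ : 0 ≤ κ) (hδ : 0 < δ)
    (hLip : ∀ x y, u₀ x - u₀ y ≤ L * ‖x - y‖) (hG : ∀ r, C * |r| ^ α ≤ G r)
    (hu : u z.1 z.2 ≤ u₀ z.1 + C * z.2 ^ α) (hv : u₀ w.1 - C * w.2 ^ α ≤ v w.1 w.2)
    (hz : 0 ≤ z.2) (hw : 0 ≤ w.2) (h₀ : z.2 = 0 ∨ w.2 = 0) :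
    doubling u v G δ κ z w ≤ L ^ 2 * δ / 2 := by
  have htime : C * z.2 ^ α + C * w.2 ^ α = C * |z.2 - w.2| ^ α := by
    rcases h₀ with h₀ | h₀
    · rw [h₀, zero_sub, abs_neg, abs_of_nonneg hw, Real.zero_rpow hα.ne', mul_zero, zero_add]
    · rw [h₀, sub_zero, abs_of_nonneg hz, Real.zero_rpow hα.ne', mul_zero, add_zero]
  have hκz : 0 ≤ κ * ‖z.1‖ := by positivity
  linarith [doubling_le u v G δ hκ z w, hLip z.1 w.1, hG (z.2 - w.2),
    mul_sub_sq_le hδ L ‖z.1 - w.1‖]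

theorem time_pos_of_lt_doubling (hα : 0 < α) (hκ : 0 ≤ κ) (hδ : 0 < δ)
    (hLip : ∀ x y, u₀ x - u₀ y ≤ L * ‖x - y‖) (hG : ∀ r, C * |r| ^ α ≤ G r)
    (hu : u z.1 z.2 ≤ u₀ z.1 + C * z.2 ^ α) (hv : u₀ w.1 - C * w.2 ^ α ≤ v w.1 w.2)
    (hz : 0 ≤ z.2) (hw : 0 ≤ w.2) (hlt : L ^ 2 * δ / 2 < doubling u v G δ κ z w) :
    0 < z.2 ∧ 0 < w.2 := by
  contrapose! hlt
  exact doubling_le_of_time_eq_zero hα hκ hδ hLip hG hu hv hz hw <|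
    hz.eq_or_lt.imp Eq.symm fun hz₀ => (hlt hz₀).antisymm hw

theorem doubling_sub_le_increment (hκ : 0 ≤ κ) (hδ : 0 < δ)
    (hLip : ∀ x y, u₀ x - u₀ y ≤ L * ‖x - y‖) (hG : ∀ r, 0 ≤ G r)
    (hu : ∀ x, u x 0 ≤ u₀ x) (hv : ∀ x, u₀ x ≤ v x 0) :
    doubling u v G δ κ z w - L ^ 2 * δ / 2 ≤
      (u z.1 z.2 - u z.1 0) - (v w.1 w.2 - v w.1 0) := by
  have hκz : 0 ≤ κ * ‖z.1‖ := by positivity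
  linarith [doubling_le u v G δ hκ z w, hLip z.1 w.1, hG (z.2 - w.2),
    mul_sub_sq_le hδ L ‖z.1 - w.1‖, hu z.1, hv w.1]

theorem IsMaxDoubling.increment_le_increment (hmax : IsMaxDoubling T u v G δ κ z w)
    (hG : ∀ r s, |r| ≤ |s| → G r ≤ G s) {τ : ℝ} (hτ : 0 ≤ τ) :
    increment (v w.1) w.2 τ ≤ increment (u z.1) z.2 τ := by
  have hmem : ∀ y ∈ closedDomain N T, (y.1, y.2 - min τ y.2) ∈ closedDomain N T := fun y hy =>
    ⟨mem_univ _, Icc_subset_Icc_right hy.2.2 (sub_min_mem_Icc hy.2.1 hτ)⟩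
  have h := hmax.le _ (hmem z hmax.left_mem) _ (hmem w hmax.right_mem)
  have hGτ := hG _ _ (abs_sub_min_sub_sub_min_le z.2 w.2 τ)
  simp only [doubling] at h
  simp only [increment]
  linarith

theorem IsMaxDoubling.separable_le (hmax : IsMaxDoubling T u v G δ κ z w) (x : Space N)
    {r : ℝ} (hr : r ∈ Icc 0 T) :
    u x r - ((2 * δ)⁻¹ * ‖x - w.1‖ ^ 2 + κ * smoothNorm 1 x) - G (r - w.2) ≤
      u z.1 z.2 - ((2 * δ)⁻¹ * ‖z.1 - w.1‖ ^ 2 + κ * smoothNorm 1 z.1) - G (z.2 - w.2) := by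
  have h := hmax.le (x, r) ⟨mem_univ _, hr⟩ w hmax.right_mem
  simp only [doubling] at h
  linarith

theorem IsSubsolution.caputo_add_le_of_isMaxDoubling (h : IsSubsolution T α ε H u₀ u)
    (hmax : IsMaxDoubling T u v G δ κ z w) (hG : ContDiff ℝ 1 G) (hz₀ : 0 < z.2) :
    caputo α (fun r => G (r - w.2)) z.2 +
      H (ε⁻¹ • z.1) (δ⁻¹ • (z.1 - w.1) + κ • ((smoothNorm 1 z.1)⁻¹ • z.1)) ≤ 0 := by
  have hg : ContDiff ℝ 1 fun r => G (r - w.2) := hG.comp (contDiff_id.sub contDiff_const)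
  exact h.caputo_add_le (contDiff_quadratic_add_smoothNorm δ κ w.1) hg.contDiffOn
    hg.continuous.continuousOn (hasGradientAt_quadratic_add_smoothNorm δ κ w.1 z.1)
    ⟨hz₀, hmax.left_mem.2.2⟩ fun x _ hr => hmax.separable_le x hr

theorem IsSubsolution.norm_slope_lt_of_isMaxDoubling {A R : ℝ} (h : IsSubsolution T α ε H u₀ u)
    (hmax : IsMaxDoubling T u v G δ κ z w) (hG : ContDiff ℝ 1 G) (hz₀ : 0 < z.2)
    (hA : -A ≤ caputo α (fun r => G (r - w.2)) z.2) (hR : ∀ y p, R ≤ ‖p‖ → A < H y p) :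
    ‖δ⁻¹ • (z.1 - w.1) + κ • ((smoothNorm 1 z.1)⁻¹ • z.1)‖ < R := by
  by_contra! hle
  linarith [h.caputo_add_le_of_isMaxDoubling hmax hG hz₀, hR (ε⁻¹ • z.1) _ hle]

theorem IsSubsolution.exists_memory_add_le_of_isMaxDoubling (hα₀ : 0 < α) (hα₁ : α < 1)
    (h : IsSubsolution T α ε H u₀ u) (hmax : IsMaxDoubling T u v G δ κ z w)
    (hu : ContinuousOn (Function.uncurry u) (closedDomain N T)) (hG : ContDiff ℝ 1 G)
    (hz₀ : 0 < z.2) :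
    ∃ C : ℝ, ∀ ρ ∈ Ioo 0 z.2, memory α ρ (u z.1) z.2 +
      H (ε⁻¹ • z.1) (δ⁻¹ • (z.1 - w.1) + κ • ((smoothNorm 1 z.1)⁻¹ • z.1)) ≤ C * ρ ^ (1 - α) :=
  h.exists_memory_add_le hα₀ hα₁ hu (contDiff_quadratic_add_smoothNorm δ κ w.1)
    (hG.comp (contDiff_id.sub contDiff_const))
    (hasGradientAt_quadratic_add_smoothNorm δ κ w.1 z.1)
    ⟨hz₀, hmax.left_mem.2.2⟩ fun x _ hr => hmax.separable_le x hr

theorem IsSupersolution.exists_le_memory_add_of_isMaxDoubling (hα₀ : 0 < α) (hα₁ : α < 1)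
    (h : IsSupersolution T α ε H u₀ v) (hmax : IsMaxDoubling T u v G δ κ z w)
    (hv : ContinuousOn (Function.uncurry v) (closedDomain N T)) (hG : ContDiff ℝ 1 G)
    (hw₀ : 0 < w.2) :
    ∃ C : ℝ, ∀ ρ ∈ Ioo 0 w.2,
      -(memory α ρ (v w.1) w.2 + H (ε⁻¹ • w.1) (δ⁻¹ • (z.1 - w.1))) ≤ C * ρ ^ (1 - α) := by
  obtain ⟨C, hC⟩ := h.neg.exists_memory_add_le hα₀ hα₁ hv.neg (contDiff_quadratic δ z.1)
    (hG.comp (contDiff_const (c := z.2).sub contDiff_id)) (hasGradientAt_quadratic δ z.1 w.1)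
    ⟨hw₀, hmax.right_mem.2.2⟩ fun y r hr => by
      have hyr := hmax.le z hmax.left_mem (y, r) ⟨mem_univ _, hr⟩
      simp only [doubling, norm_sub_rev z.1] at hyr
      simp only [Function.comp_apply, id]
      linarith
  refine ⟨C, fun ρ hρ => ?_⟩
  have hCρ := hC ρ hρ
  rw [memory_neg, ← smul_neg, neg_sub] at hCρ
  linarith

theorem IsMaxDoubling.le_hamiltonian_sub (hα₀ : 0 < α) (hα₁ : α < 1)
    (hmax : IsMaxDoubling T u v G δ κ z w) (h : IsSubsolution T α ε H u₀ u)
    (h' : IsSupersolution T α ε H u₀ v)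
    (hu : ContinuousOn (Function.uncurry u) (closedDomain N T))
    (hv : ContinuousOn (Function.uncurry v) (closedDomain N T)) (hG : ContDiff ℝ 1 G)
    (hG_mono : ∀ r s, |r| ≤ |s| → G r ≤ G s) (hz₀ : 0 < z.2) (hw₀ : 0 < w.2)
    (hθ : θ ≤ (u z.1 z.2 - u z.1 0) - (v w.1 w.2 - v w.1 0)) :
    α / Real.Gamma (1 - α) * (θ * (T ^ (-α) / α)) ≤ H (ε⁻¹ • w.1) (δ⁻¹ • (z.1 - w.1)) -
      H (ε⁻¹ • z.1) (δ⁻¹ • (z.1 - w.1) + κ • ((smoothNorm 1 z.1)⁻¹ • z.1)) := by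
  obtain ⟨C, hC⟩ := h.exists_memory_add_le_of_isMaxDoubling hα₀ hα₁ hmax hu hG hz₀
  obtain ⟨C', hC'⟩ := h'.exists_le_memory_add_of_isMaxDoubling hα₀ hα₁ hmax hv hG hw₀
  have hlim : Tendsto (fun ρ : ℝ => (C + C') * ρ ^ (1 - α)) (𝓝[>] 0) (𝓝 0) := by
    have := ((Real.continuous_rpow_const (sub_nonneg.2 hα₁.le)).const_mul (C + C')).tendsto 0
    rw [Real.zero_rpow (sub_pos.2 hα₁).ne', mul_zero] at this
    exact this.mono_left nhdsWithin_le_nhds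
  refine sub_nonpos.1 (ge_of_tendsto hlim ?_)
  filter_upwards [Ioo_mem_nhdsGT hz₀, Ioo_mem_nhdsGT hw₀] with ρ hρz hρw
  have hz := hmax.left_mem.2
  have hw := hmax.right_mem.2
  have hmem := le_memory_sub_memory hα₀ hα₁ hz hw hρz.1 (hρz.2.le.trans hz.2)
    (continuousOn_section hu z.1 hz.2) (continuousOn_section hv w.1 hw.2)
    (fun τ hτ => hmax.increment_le_increment hG_mono hτ.le) hθ
  linarith [hC ρ hρz, hC' ρ hρw]

end DoublingMax

theorem sub_lt_of_norm_slope_le {H : Space N → Space N → ℝ} {ε δ R c d : ℝ} (hε : 0 < ε)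
    (hδ : 0 < δ) (hd : ∀ x y p q, ‖p‖ ≤ R + 1 → ‖q‖ ≤ R + 1 → ‖x - y‖ < d → ‖p - q‖ < d →
      |H x p - H y q| < c)
    (hδd : ε⁻¹ * (R + 1) * δ < d) {a b q : Space N} (hpq : ‖δ⁻¹ • (a - b) + q‖ ≤ R)
    (hq : ‖q‖ ≤ 1) (hqd : ‖q‖ < d) :
    H (ε⁻¹ • b) (δ⁻¹ • (a - b)) - H (ε⁻¹ • a) (δ⁻¹ • (a - b) + q) < c := by
  set p := δ⁻¹ • (a - b) with hp
  have hpR : ‖p‖ ≤ R + 1 := by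
    have := norm_sub_le (p + q) q
    rw [add_sub_cancel_right] at this
    linarith
  have hab : ‖ε⁻¹ • b - ε⁻¹ • a‖ < d := by
    have hδp : a - b = δ • p := by rw [hp, smul_inv_smul₀ hδ.ne']
    rw [← smul_sub, norm_smul, norm_sub_rev, hδp, norm_smul, Real.norm_of_nonneg hδ.le,
      Real.norm_of_nonneg (inv_nonneg.2 hε.le)]
    calc ε⁻¹ * (δ * ‖p‖) ≤ ε⁻¹ * (δ * (R + 1)) := by gcongr
      _ = ε⁻¹ * (R + 1) * δ := by ring
      _ < d := hδd
  refine (abs_lt.1 (hd _ _ _ _ hpR (hpq.trans (by linarith)) hab ?_)).2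
  rwa [sub_add_cancel_left, norm_neg]

theorem norm_smul_smoothNorm_inv_smul_le {κ : ℝ} (hκ : 0 ≤ κ) (x : Space N) :
    ‖κ • ((smoothNorm 1 x)⁻¹ • x)‖ ≤ κ := by
  rw [norm_smul, Real.norm_of_nonneg hκ]
  exact mul_le_of_le_one_right hκ (norm_smoothNorm_inv_smul_le one_pos x)

theorem exists_pos_mul_lt_and_mul_lt (a b : ℝ) {c d : ℝ} (hc : 0 < c) (hd : 0 < d) :
    ∃ δ : ℝ, 0 < δ ∧ a * δ < c ∧ b * δ < d := by
  obtain ⟨δ, hδ, hlt⟩ := exists_pos_mul_lt (lt_min hc hd) (max a b)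
  rw [lt_min_iff] at hlt
  exact ⟨δ, hδ, (mul_le_mul_of_nonneg_right (le_max_left _ _) hδ.le).trans_lt hlt.1,
    (mul_le_mul_of_nonneg_right (le_max_right _ _) hδ.le).trans_lt hlt.2⟩

section TimeRegularity

variable {T α ε L C : ℝ} {H : Space N → Space N → ℝ} {u₀ : Space N → ℝ} {u v : Space N → ℝ → ℝ}

theorem exists_forall_doubling_lt {η θ : ℝ} (hT : 0 < T) (hα₀ : 0 < α) (hα₁ : α < 1) (hε : 0 < ε)
    (hH : IsLocallyBUC H) (hcoer : Coercive H) (h : IsSubsolution T α ε H u₀ u)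
    (h' : IsSupersolution T α ε H u₀ v)
    (hu : ContinuousOn (Function.uncurry u) (closedDomain N T))
    (hv : ContinuousOn (Function.uncurry v) (closedDomain N T))
    (hbu : IsBounded T u) (hbv : IsBounded T v) (hLip : ∀ x y, u₀ x - u₀ y ≤ L * ‖x - y‖)
    (hC : 0 ≤ C) (hinit : ∀ x, ∀ t ∈ Icc 0 T, u x t ≤ u₀ x + C * t ^ α)
    (hinit' : ∀ x, ∀ t ∈ Icc 0 T, u₀ x - C * t ^ α ≤ v x t)
    (hη : 0 < η) (hη₁ : η ≤ 1) (hθ : 0 < θ) :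
    ∃ δ : ℝ, ∀ᶠ κ in 𝓝[>] 0, ∀ z ∈ closedDomain N T, ∀ w ∈ closedDomain N T,
      doubling u v (smoothPow α C η) δ κ z w < θ := by
  obtain ⟨A, -, hA⟩ := exists_neg_log_le_caputo_smoothPow T hα₀ hα₁ hC
  obtain ⟨R, hR⟩ := hcoer.exists_radius (A * (1 + Real.log (1 / η)))
  have hc : 0 < α / Real.Gamma (1 - α) * (θ / 2 * (T ^ (-α) / α)) := by
    have := div_Gamma_one_sub_pos hα₀ hα₁
    positivity
  obtain ⟨d, hd, hHd⟩ := hH.exists_forall_norm_sub_lt (R + 1) hc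
  obtain ⟨δ, hδ, hδL, hδd⟩ := exists_pos_mul_lt_and_mul_lt (L ^ 2) (ε⁻¹ * (R + 1)) hθ hd
  refine ⟨δ, ?_⟩
  filter_upwards [Ioo_mem_nhdsGT (lt_min one_pos hd)] with κ ⟨hκ, hκd⟩ z₀ hz₀ w₀ hw₀
  by_contra! hθ₀
  have hG := contDiff_smoothPow α C hη
  obtain ⟨z, w, hmax⟩ := exists_isMaxDoubling hu hv hbu hbv hG.continuous
    (smoothPow_nonneg hC η) hδ hκ hz₀ hw₀ (hθ.le.trans hθ₀)
  have hz := hmax.left_mem.2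
  have hw := hmax.right_mem.2
  have hθzw := hθ₀.trans (hmax.le z₀ hz₀ w₀ hw₀)
  obtain ⟨hz_pos, hw_pos⟩ := time_pos_of_lt_doubling hα₀ hκ.le hδ hLip
    (mul_abs_rpow_le_smoothPow hα₀.le hC η) (hinit _ _ hz) (hinit' _ _ hw) hz.1 hw.1
    (show L ^ 2 * δ / 2 < doubling u v (smoothPow α C η) δ κ z w by linarith)
  have hslope := h.norm_slope_lt_of_isMaxDoubling hmax hG hz_pos
    (hA η w.2 z.2 hη hη₁ ⟨hz_pos, hz.2⟩) hR
  have hθ_le : θ / 2 ≤ (u z.1 z.2 - u z.1 0) - (v w.1 w.2 - v w.1 0) := by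
    linarith [doubling_sub_le_increment (z := z) (w := w) hκ.le hδ hLip
      (smoothPow_nonneg (α := α) hC η) h.2.1 h'.2.1]
  have hq := norm_smul_smoothNorm_inv_smul_le hκ.le z.1
  rw [lt_min_iff] at hκd
  exact (hmax.le_hamiltonian_sub hα₀ hα₁ h h' hu hv hG
    (fun _ _ => smoothPow_mono hα₀.le hC η) hz_pos hw_pos hθ_le).not_gt <|
      sub_lt_of_norm_slope_le hε hδ hHd hδd hslope.le (hq.trans hκd.1.le) (hq.trans_lt hκd.2)

theorem IsSubsolution.sub_le_mul_abs_rpow (hT : 0 < T) (hα₀ : 0 < α) (hα₁ : α < 1) (hε : 0 < ε)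
    (hH : IsLocallyBUC H) (hcoer : Coercive H) (h : IsSubsolution T α ε H u₀ u)
    (h' : IsSupersolution T α ε H u₀ v)
    (hu : ContinuousOn (Function.uncurry u) (closedDomain N T))
    (hv : ContinuousOn (Function.uncurry v) (closedDomain N T))
    (hbu : IsBounded T u) (hbv : IsBounded T v) (hLip : ∀ x y, u₀ x - u₀ y ≤ L * ‖x - y‖)
    (hC : 0 ≤ C) (hinit : ∀ x, ∀ t ∈ Icc 0 T, u x t ≤ u₀ x + C * t ^ α)
    (hinit' : ∀ x, ∀ t ∈ Icc 0 T, u₀ x - C * t ^ α ≤ v x t)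
    (x : Space N) {t s : ℝ} (ht : t ∈ Icc 0 T) (hs : s ∈ Icc 0 T) :
    u x t - v x s ≤ C * |t - s| ^ α := by
  refine le_of_forall_pos_le_add fun e he => ?_
  obtain ⟨η, hη, hη₁, hηe⟩ := exists_mul_rpow_le hα₀ C (half_pos he)
  obtain ⟨δ, hδ⟩ := exists_forall_doubling_lt hT hα₀ hα₁ hε hH hcoer h h' hu hv hbu hbv hLip hC
    hinit hinit' hη hη₁ (half_pos he)
  have hlim : Tendsto (fun κ => doubling u v (smoothPow α C η) δ κ (x, t) (x, s)) (𝓝[>] 0)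
      (𝓝 (doubling u v (smoothPow α C η) δ 0 (x, t) (x, s))) := by
    refine (Continuous.tendsto ?_ 0).mono_left nhdsWithin_le_nhds
    unfold doubling
    fun_prop
  have hle := le_of_tendsto hlim
    (hδ.mono fun κ hκ => (hκ (x, t) ⟨mem_univ _, ht⟩ (x, s) ⟨mem_univ _, hs⟩).le)
  have hG := (abs_le.1 (abs_smoothPow_sub_le_rpow hα₀.le hα₁.le hC η (t - s) 0)).2
  rw [smoothPow_zero hη.le, sub_zero] at hG
  simp only [doubling, sub_self, norm_zero, zero_mul, ne_eq, OfNat.ofNat_ne_zero,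
    not_false_eq_true, zero_pow, mul_zero, sub_zero] at hle
  linarith

end TimeRegularity

theorem norm_lt_of_norm_smul_smoothNorm_lt {σ R : ℝ} (hσ : 0 < σ) (hR : 0 < R) {x : Space N}
    (h : ‖(2 * R) • ((smoothNorm σ x)⁻¹ • x)‖ < R) : ‖x‖ < σ := by
  have hpos := smoothNorm_pos hσ x
  rw [norm_smul, norm_smul, norm_inv, Real.norm_of_nonneg hpos.le,
    Real.norm_of_nonneg (by positivity), mul_comm 2 R, mul_assoc, mul_lt_iff_lt_one_right hR,
    mul_left_comm, inv_mul_lt_iff₀ hpos, mul_one] at h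
  linarith [smoothNorm_le_norm_add hσ.le x]

section SpaceRegularity

variable {T α ε L C A R η : ℝ} {H : Space N → Space N → ℝ} {u₀ : Space N → ℝ}
  {u : Space N → ℝ → ℝ}

/- At a positive time the gradient of the barrier at a maximum has norm less than `R`, which forces
the point to lie within `σ` of the vertex `y`; the time estimate then applies at `y`. -/
theorem IsSubsolution.le_of_max_barrier {σ e : ℝ} (hα : 0 ≤ α) (h : IsSubsolution T α ε H u₀ u)
    (hLip : ∀ x y, u x 0 - u y 0 ≤ L * ‖x - y‖)
    (htime : ∀ x, ∀ t ∈ Icc 0 T, ∀ s ∈ Icc 0 T, u x t - u x s ≤ C * |t - s| ^ α) (hC : 0 ≤ C)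
    (hη : 0 < η) (hA : ∀ s t, t ∈ Ioc 0 T → -A ≤ caputo α (fun r => smoothPow α C η (r - s)) t)
    (hR₀ : 0 < R) (hLR : L ≤ R) (hR : ∀ y p, R ≤ ‖p‖ → A < H y p) (hσ : 0 < σ) (he : 0 ≤ e)
    {y a : Space N} {t s : ℝ} (ht : t ∈ Icc 0 T) (hs : s ∈ Icc 0 T)
    (hy : ∀ x, ‖x - y‖ < σ → u x t ≤ u y t + e)
    (hmax : ∀ x, ∀ r ∈ Icc 0 T,
      u x r - 2 * R * smoothNorm σ (x - y) - smoothPow α C η (r - t) ≤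
        u a s - 2 * R * smoothNorm σ (a - y) - smoothPow α C η (s - t)) :
    u a s - 2 * R * smoothNorm σ (a - y) - smoothPow α C η (s - t) ≤ u y t + e := by
  have hpow := mul_abs_rpow_le_smoothPow hα hC η (s - t)
  rcases hs.1.eq_or_lt with rfl | hs₀
  · have hbarrier : L * ‖a - y‖ ≤ 2 * R * smoothNorm σ (a - y) :=
      mul_le_mul (by linarith) (norm_le_smoothNorm σ _) (norm_nonneg _) (by positivity)
    linarith [hLip a y, htime y 0 hs t ht]
  · have hg : ContDiff ℝ 1 fun r => smoothPow α C η (r - t) :=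
      (contDiff_smoothPow α C hη).comp (contDiff_id.sub contDiff_const)
    have hψ : ContDiff ℝ 1 fun x => 2 * R * smoothNorm σ (x - y) :=
      contDiff_const.mul ((contDiff_smoothNorm hσ).comp (contDiff_id.sub contDiff_const))
    have htest := h.caputo_add_le hψ hg.contDiffOn hg.continuous.continuousOn
      (hasGradientAt_const_mul (hasGradientAt_smoothNorm_sub hσ y a) (2 * R)) ⟨hs₀, hs.2⟩ hmax
    have hay : ‖a - y‖ < σ := norm_lt_of_norm_smul_smoothNorm_lt hσ hR₀ <| by
      by_contra! hle
      linarith [hA t s ⟨hs₀, hs.2⟩, hR (ε⁻¹ • a) _ hle]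
    have hbarrier : 0 ≤ 2 * R * smoothNorm σ (a - y) :=
      mul_nonneg (by positivity) (smoothNorm_nonneg σ _)
    linarith [htime a s hs t ht, hy a hay]

theorem IsSubsolution.sub_le_mul_norm_add (hT : 0 ≤ T) (hα : 0 ≤ α)
    (h : IsSubsolution T α ε H u₀ u) (hu : ContinuousOn (Function.uncurry u) (closedDomain N T))
    (hb : IsBounded T u) (hLip : ∀ x y, u x 0 - u y 0 ≤ L * ‖x - y‖)
    (htime : ∀ x, ∀ t ∈ Icc 0 T, ∀ s ∈ Icc 0 T, u x t - u x s ≤ C * |t - s| ^ α) (hC : 0 ≤ C)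
    (hη : 0 < η) (hA : ∀ s t, t ∈ Ioc 0 T → -A ≤ caputo α (fun r => smoothPow α C η (r - s)) t)
    (hR₀ : 0 < R) (hLR : L ≤ R) (hR : ∀ y p, R ≤ ‖p‖ → A < H y p) (x y : Space N) {t : ℝ}
    (ht : t ∈ Icc 0 T) : u x t - u y t ≤ 2 * R * ‖x - y‖ + C * η ^ α := by
  refine le_of_forall_pos_le_add fun e he => ?_
  have hut : Continuous fun x => u x t :=
    hu.comp_continuous (Continuous.prodMk_left t) fun x => ⟨mem_univ x, ht⟩
  obtain ⟨r, hr, hru⟩ := Metric.continuous_iff.1 hut y (e / 2) (half_pos he)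
  obtain ⟨σ', hσ', hσe⟩ := exists_pos_mul_lt (half_pos he) (2 * R)
  set σ := min r σ'
  have hσ : 0 < σ := lt_min hr hσ'
  have hψ : Continuous fun x => 2 * R * smoothNorm σ (x - y) :=
    continuous_const.mul ((contDiff_smoothNorm (E := Space N) hσ).continuous.comp
      (continuous_id.sub continuous_const))
  have hg : Continuous fun r => smoothPow α C η (r - t) :=
    (contDiff_smoothPow α C hη).continuous.comp (continuous_id.sub continuous_const)
  obtain ⟨a, s, hs, hmax⟩ := exists_max_separable hT hu hb hψ hg.continuousOn (a := y)
    (show 0 < 2 * R by positivity) fun x => by gcongr; exact norm_le_smoothNorm σ (x - y)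
  have hvalue := (hmax x t ht).trans <|
    h.le_of_max_barrier hα hLip htime hC hη hA hR₀ hLR hR hσ (half_pos he).le ht hs (fun x hx => by
      have := (abs_lt.1 (hru x ((dist_eq_norm x y).trans_lt (hx.trans_le (min_le_left _ _))))).2
      linarith) hmax
  rw [sub_self, smoothPow_zero hη.le] at hvalue
  have hx : 2 * R * smoothNorm σ (x - y) ≤ 2 * R * (‖x - y‖ + σ') := by
    gcongr
    exact (smoothNorm_le_norm_add hσ.le _).trans (by gcongr; exact min_le_right _ _)
  linarith

end SpaceRegularity

/-- `ω` bounds the oscillation in space of every bounded viscosity solution, uniformly in the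
scale `ε` and in time. It need not be a modulus of continuity. -/
def HasSpaceModulus (T α : ℝ) (H : Space N → Space N → ℝ) (u₀ : Space N → ℝ) (ω : ℝ → ℝ) : Prop :=
  ∀ ε : ℝ, 0 < ε → ∀ u : Space N → ℝ → ℝ, IsViscositySolution T α ε H u₀ u → IsBounded T u →
    ∀ x y, ∀ t ∈ Icc 0 T, |u x t - u y t| ≤ ω ‖x - y‖

theorem LipBUC.exists_sub_le {u₀ : Space N → ℝ} (h : LipBUC u₀) :
    ∃ L : ℝ, 0 < L ∧ ∀ x y, u₀ x - u₀ y ≤ L * ‖x - y‖ := by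
  obtain ⟨⟨K, hK⟩, -⟩ := h
  refine ⟨K + 1, by positivity, fun x y => ?_⟩
  have := hK.dist_le_mul x y
  rw [Real.dist_eq, dist_eq_norm] at this
  nlinarith [le_abs_self (u₀ x - u₀ y), norm_nonneg (x - y)]

theorem IsBounded.neg {T : ℝ} {u : Space N → ℝ → ℝ} (h : IsBounded T u) :
    IsBounded T fun x t => -u x t := by
  simpa only [IsBounded, abs_neg] using h

section UniformEstimates

variable {T α : ℝ} {H : Space N → Space N → ℝ} {u₀ : Space N → ℝ} {ω : ℝ → ℝ}

theorem HasSpaceModulus.of_forall_pos (h₀ : 0 ≤ ω 0)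
    (h : ∀ r, 0 < r → ∃ ω', HasSpaceModulus T α H u₀ ω' ∧ ω' r ≤ ω r) :
    HasSpaceModulus T α H u₀ ω := by
  intro ε hε u hu hb x y t ht
  rcases eq_or_ne x y with rfl | hxy
  · simpa only [sub_self, abs_zero, norm_zero] using h₀
  · obtain ⟨ω', hω', hle⟩ := h ‖x - y‖ (norm_sub_pos_iff.2 hxy)
    exact (hω' ε hε u hu hb x y t ht).trans hle

theorem exists_abs_sub_initial_le (hT : 0 ≤ T) (hα₀ : 0 < α) (hα₁ : α < 1) (hH : IsLocallyBUC H)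
    {L : ℝ} (hL : 0 < L) (hLip : ∀ x y, u₀ x - u₀ y ≤ L * ‖x - y‖) :
    ∃ C : ℝ, 0 ≤ C ∧ ∀ (ε : ℝ) (u : Space N → ℝ → ℝ), IsViscositySolution T α ε H u₀ u →
      IsBounded T u → ∀ x, ∀ t ∈ Icc 0 T, |u x t - u₀ x| ≤ C * t ^ α := by
  obtain ⟨A, hA⟩ := (hH L).2
  have hA₀ : 0 ≤ A := (abs_nonneg _).trans (hA 0 0 (norm_zero.trans_le hL.le))
  have hΓ : 0 < Real.Gamma (1 - α) := Real.Gamma_pos_of_pos (sub_pos.2 hα₁)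
  have hAC : A < (A + 1) * Real.Gamma (1 - α) / Real.Gamma (1 - α) := by
    rw [mul_div_cancel_right₀ _ hΓ.ne']
    exact lt_add_one A
  refine ⟨(A + 1) * Real.Gamma (1 - α), by positivity, fun ε u hu hb x t ht => abs_le.2 ?_⟩
  have hupper := hu.2.1.le_add_mul_rpow hT hα₀ hα₁ hu.1 hb hL hLip
    (fun x p hp => (abs_le.1 (hA x p hp)).1) (by positivity) hAC x ht
  have hlower := hu.2.2.neg.le_add_mul_rpow hT hα₀ hα₁ hu.1.neg hb.neg hL
    (fun x y => by rw [neg_sub_neg, norm_sub_rev]; exact hLip y x)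
    (fun x p hp => neg_le_neg (abs_le.1 (hA x (-p) ((norm_neg p).trans_le hp))).2)
    (by positivity) hAC x ht
  constructor <;> linarith

theorem exists_hasSpaceModulus_affine (hT : 0 < T) (hα₀ : 0 < α) (hα₁ : α < 1)
    (hH : IsLocallyBUC H) (hcoer : Coercive H) (hu₀ : LipBUC u₀) :
    ∃ L C A : ℝ, 0 < L ∧ 0 ≤ C ∧ 0 ≤ A ∧ ∀ η R : ℝ, 0 < η → η ≤ 1 → L ≤ R →
      (∀ y p, R ≤ ‖p‖ → A * (1 + Real.log (1 / η)) < H y p) →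
        HasSpaceModulus T α H u₀ fun r => 2 * R * r + C * η ^ α := by
  obtain ⟨L, hL, hLip⟩ := hu₀.exists_sub_le
  obtain ⟨C, hC, hinit⟩ := exists_abs_sub_initial_le hT.le hα₀ hα₁ hH hL hLip
  obtain ⟨A, hA₀, hA⟩ := exists_neg_log_le_caputo_smoothPow T hα₀ hα₁ hC
  refine ⟨L, C, A, hL, hC, hA₀, fun η R hη hη₁ hLR hR ε hε u hu hb x y t ht => ?_⟩
  have hinit' := fun x t ht => abs_le.1 (hinit ε u hu hb x t ht)
  have htime : ∀ x, ∀ t ∈ Icc 0 T, ∀ s ∈ Icc 0 T, u x t - u x s ≤ C * |t - s| ^ α :=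
    fun x t ht s hs => hu.2.1.sub_le_mul_abs_rpow hT hα₀ hα₁ hε hH hcoer hu.2.2 hu.1 hu.1 hb hb hLip
      hC (fun x t ht => by linarith [hinit' x t ht]) (fun x t ht => by linarith [hinit' x t ht])
      x ht hs
  have hspace : ∀ x y, u x t - u y t ≤ 2 * R * ‖x - y‖ + C * η ^ α := fun x y =>
    hu.2.1.sub_le_mul_norm_add hT.le hα₀.le hu.1 hb
      (fun x y => by linarith [hu.2.1.2.1 x, hu.2.2.2.1 y, hLip x y]) htime hC hη
      (fun s t ht => hA η s t hη hη₁ ht) (hL.trans_le hLR) hLR hR x y ht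
  have hyx := hspace y x
  rw [norm_sub_rev] at hyx
  exact abs_le.2 ⟨by linarith, hspace x y⟩

theorem exists_hasSpaceModulus_const (hT : 0 ≤ T) (hα₀ : 0 < α) (hα₁ : α < 1)
    (hH : IsLocallyBUC H) (hu₀ : LipBUC u₀) :
    ∃ B : ℝ, 0 ≤ B ∧ HasSpaceModulus T α H u₀ fun _ => B := by
  obtain ⟨L, hL, hLip⟩ := hu₀.exists_sub_le
  obtain ⟨C, hC, hinit⟩ := exists_abs_sub_initial_le hT hα₀ hα₁ hH hL hLip
  obtain ⟨-, -, B, hB⟩ := hu₀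
  have hB₀ : 0 ≤ B := (abs_nonneg _).trans (hB 0)
  refine ⟨2 * (B + C * T ^ α), by positivity, fun ε _ u hu hb x y t ht => ?_⟩
  have hbound : ∀ z, |u z t| ≤ B + C * T ^ α := fun z => by
    have hCt : C * t ^ α ≤ C * T ^ α :=
      mul_le_mul_of_nonneg_left (Real.rpow_le_rpow ht.1 ht.2 hα₀.le) hC
    linarith [abs_sub_abs_le_abs_sub (u z t) (u₀ z), hinit ε u hu hb z t ht, hB z]
  linarith [abs_sub (u x t) (u y t), hbound x, hbound y]

end UniformEstimates

section Moduli

variable {ι : Type*} {a b : ι → ℝ}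

theorem bddBelow_range_affine (ha : ∀ i, 0 ≤ a i) (hb : ∀ i, 0 ≤ b i) {r : ℝ} (hr : 0 ≤ r) :
    BddBelow (range fun i => a i * r + b i) :=
  ⟨0, forall_mem_range.2 fun i => add_nonneg (mul_nonneg (ha i) hr) (hb i)⟩

theorem concaveOn_iInf_affine [Nonempty ι] (ha : ∀ i, 0 ≤ a i) (hb : ∀ i, 0 ≤ b i) :
    ConcaveOn ℝ (Ici 0) fun r => ⨅ i, (a i * r + b i) := by
  refine ⟨convex_Ici 0, fun r hr s hs c d hc hd hcd => le_ciInf fun i => ?_⟩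
  have hri := mul_le_mul_of_nonneg_left (ciInf_le (bddBelow_range_affine ha hb hr) i) hc
  have hsi := mul_le_mul_of_nonneg_left (ciInf_le (bddBelow_range_affine ha hb hs) i) hd
  simp only [smul_eq_mul]
  linear_combination hri + hsi + b i * hcd

theorem isModulus_iInf_affine [Nonempty ι] (ha : ∀ i, 0 ≤ a i) (hb : ∀ i, 0 ≤ b i)
    (h : ∀ e, 0 < e → ∃ i, b i ≤ e) :
    IsModulus fun r => ⨅ i, (a i * r + b i) := by
  set ω : ℝ → ℝ := fun r => ⨅ i, (a i * r + b i)
  have hle : ∀ r, 0 ≤ r → ∀ i, ω r ≤ a i * r + b i := fun r hr =>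
    ciInf_le (bddBelow_range_affine ha hb hr)
  have hnonneg : ∀ r, 0 ≤ r → 0 ≤ ω r := fun r hr =>
    le_ciInf fun i => add_nonneg (mul_nonneg (ha i) hr) (hb i)
  have hzero : ω 0 = 0 := by
    refine le_antisymm (le_of_forall_pos_le_add fun e he => ?_) (hnonneg 0 le_rfl)
    obtain ⟨i, hi⟩ := h e he
    linarith [hle 0 le_rfl i]
  refine ⟨fun r hr => ?_, fun r hr s _ hrs => ?_, hzero⟩
  · rcases (mem_Ici.1 hr).eq_or_lt with rfl | hr₀
    · rw [ContinuousWithinAt, hzero]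
      refine tendsto_order.2 ⟨fun c hc => ?_, fun c hc => ?_⟩
      · filter_upwards [self_mem_nhdsWithin] with r hr using hc.trans_le (hnonneg r hr)
      · obtain ⟨i, hi⟩ := h (c / 2) (half_pos hc)
        have hlim : Tendsto (fun r => a i * r + b i) (𝓝[≥] 0) (𝓝 (a i * 0 + b i)) :=
          (Continuous.tendsto (by fun_prop) 0).mono_left nhdsWithin_le_nhds
        filter_upwards [hlim.eventually_lt_const (show a i * 0 + b i < c by linarith),
          self_mem_nhdsWithin] with r hrc hr using (hle r hr i).trans_lt hrc
    · have hconcave := (concaveOn_iInf_affine ha hb).subset Ioi_subset_Ici_self (convex_Ioi 0)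
      exact ((hconcave.continuousOn isOpen_Ioi).continuousAt
        (Ioi_mem_nhds hr₀)).continuousWithinAt
  · exact le_ciInf fun i => (hle r hr i).trans
      (add_le_add_left (mul_le_mul_of_nonneg_left hrs (ha i)) _)

end Moduli

theorem exists_rpow_le_and_log_le {α r : ℝ} (hα : 0 < α) (hr : 0 < r) :
    ∃ η : ℝ, 0 < η ∧ η ≤ 1 ∧ η ^ α ≤ r ∧ Real.log (1 / η) ≤ |Real.log r| / α := by
  have hm : 0 < min r 1 := lt_min hr one_pos
  refine ⟨min r 1 ^ α⁻¹, by positivity,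
    Real.rpow_le_one hm.le (min_le_right _ _) (by positivity), ?_, ?_⟩
  · rw [Real.rpow_inv_rpow hm.le hα.ne']
    exact min_le_left _ _
  · rw [one_div, Real.log_inv, Real.log_rpow hm, ← mul_neg, inv_mul_eq_div]
    gcongr
    rcases le_total r 1 with h | h
    · rw [min_eq_left h]
      exact neg_le_abs _
    · rw [min_eq_right h, Real.log_one, neg_zero]
      exact abs_nonneg _

theorem one_add_log_mul_le_rpow {r ν : ℝ} (hr : 0 < r) (hr₁ : r ≤ 1) (hν : ν < 1) :
    (1 + |Real.log r|) * r ≤ (1 + 1 / (1 - ν)) * r ^ ν := by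
  have hpos := Real.rpow_pos_of_pos hr (1 - ν)
  have hlog := (Real.abs_log_mul_self_rpow_lt r (1 - ν) hr hr₁ (sub_pos.2 hν)).le
  rw [abs_mul, abs_of_nonneg hpos.le] at hlog
  have hone : r ^ (1 - ν) ≤ 1 := Real.rpow_le_one hr.le hr₁ (sub_nonneg.2 hν.le)
  have hsplit : r = r ^ (1 - ν) * r ^ ν := by
    rw [← Real.rpow_add hr, sub_add_cancel, Real.rpow_one]
  calc (1 + |Real.log r|) * r = (r ^ (1 - ν) + |Real.log r| * r ^ (1 - ν)) * r ^ ν := by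
        linear_combination (1 + |Real.log r|) * hsplit
    _ ≤ (1 + 1 / (1 - ν)) * r ^ ν := by gcongr

section MainEstimates

variable {T α : ℝ} {H : Space N → Space N → ℝ} {u₀ : Space N → ℝ}

theorem exists_isModulus_hasSpaceModulus (hT : 0 < T) (hα₀ : 0 < α) (hα₁ : α < 1)
    (hH : IsLocallyBUC H) (hcoer : Coercive H) (hu₀ : LipBUC u₀) :
    ∃ ω : ℝ → ℝ, IsModulus ω ∧ HasSpaceModulus T α H u₀ ω := by
  obtain ⟨L, C, A, hL, hC, -, hmod⟩ := exists_hasSpaceModulus_affine hT hα₀ hα₁ hH hcoer hu₀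
  choose R hR using fun η : Ioc (0 : ℝ) 1 => hcoer.exists_radius (A * (1 + Real.log (1 / η)))
  have : Nonempty (Ioc (0 : ℝ) 1) := ⟨⟨1, one_pos, le_rfl⟩⟩
  refine ⟨fun r => ⨅ η : Ioc (0 : ℝ) 1, (2 * max (R η) L * r + C * (η : ℝ) ^ α),
    isModulus_iInf_affine (fun η => ?_) (fun η => ?_) (fun e he => ?_),
    fun ε hε u hu hb x y t ht => le_ciInf fun η => ?_⟩
  · exact mul_nonneg zero_le_two (hL.le.trans (le_max_right _ _))
  · exact mul_nonneg hC (Real.rpow_nonneg η.2.1.le α)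
  · obtain ⟨η, hη, hη₁, hηe⟩ := exists_mul_rpow_le hα₀ C he
    exact ⟨⟨η, hη, hη₁⟩, hηe⟩
  · exact hmod η _ η.2.1 η.2.2 (le_max_right _ _)
      (fun y p hp => hR η y p ((le_max_left _ _).trans hp)) ε hε u hu hb x y t ht

theorem exists_hasSpaceModulus_log (hT : 0 < T) (hα₀ : 0 < α) (hα₁ : α < 1)
    (hH : IsLocallyBUC H) (hcoer : Coercive H) (hu₀ : LipBUC u₀) (hG : LinearGrowth H) :
    ∃ C : ℝ, 0 < C ∧ HasSpaceModulus T α H u₀ fun r => C * (1 + |Real.log r|) * r := by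
  obtain ⟨L, C, A, hL, hC, hA, hmod⟩ := exists_hasSpaceModulus_affine hT hα₀ hα₁ hH hcoer hu₀
  obtain ⟨K, hK, hradius⟩ := hG.exists_radius
  refine ⟨2 * (K * (1 + A + A / α) + L) + C, by positivity,
    .of_forall_pos (by rw [mul_zero]) fun r hr => ?_⟩
  obtain ⟨η, hη, hη₁, hηr, hlog⟩ := exists_rpow_le_and_log_le hα₀ hr
  set ℓ := |Real.log r|
  have : 0 ≤ ℓ := abs_nonneg _
  refine ⟨_, hmod η (K * (1 + A * (1 + ℓ / α)) + L) hη hη₁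
    (le_add_of_nonneg_left (by positivity)) fun y p hp => ?_, ?_⟩
  · have hA_log : A * (1 + Real.log (1 / η)) ≤ A * (1 + ℓ / α) := by gcongr
    exact hA_log.trans_lt (hradius _ (by positivity) y p (by linarith))
  · calc 2 * (K * (1 + A * (1 + ℓ / α)) + L) * r + C * η ^ α
        ≤ 2 * (K * (1 + A * (1 + ℓ / α)) + L) * r + C * r := by gcongr
      _ = (2 * (K * (1 + A + A / α * ℓ) + L) + C) * r := by ring
      _ ≤ (2 * (K * (1 + A + A / α) + L) + C) * (1 + ℓ) * r := by
        refine mul_le_mul_of_nonneg_right ?_ hr.le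
        have hgap : 0 ≤ 2 * (K * (A / α + (1 + A) * ℓ) + L * ℓ) + C * ℓ := by positivity
        linear_combination hgap

theorem exists_hasSpaceModulus_rpow {C ν : ℝ} (hT : 0 ≤ T) (hα₀ : 0 < α) (hα₁ : α < 1)
    (hH : IsLocallyBUC H) (hu₀ : LipBUC u₀) (hC : 0 < C)
    (hlog : HasSpaceModulus T α H u₀ fun r => C * (1 + |Real.log r|) * r) (hν₀ : 0 ≤ ν)
    (hν₁ : ν < 1) : ∃ C : ℝ, 0 < C ∧ HasSpaceModulus T α H u₀ fun r => C * r ^ ν := by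
  obtain ⟨B, hB, hconst⟩ := exists_hasSpaceModulus_const hT hα₀ hα₁ hH hu₀
  have : 0 < 1 - ν := sub_pos.2 hν₁
  refine ⟨C * (1 + 1 / (1 - ν)) + B, by positivity, .of_forall_pos (by positivity) fun r hr => ?_⟩
  have := Real.rpow_pos_of_pos hr ν
  rcases le_total r 1 with hr₁ | hr₁
  · refine ⟨_, hlog, ?_⟩
    have hB_rpow : 0 ≤ B * r ^ ν := by positivity
    linarith [mul_le_mul_of_nonneg_left (one_add_log_mul_le_rpow hr hr₁ hν₁) hC.le]
  · refine ⟨_, hconst, ?_⟩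
    have hC_rpow : 0 ≤ C * (1 + 1 / (1 - ν)) * r ^ ν := by positivity
    linarith [le_mul_of_one_le_right hB (Real.one_le_rpow hr₁ hν₀)]

end MainEstimates

end

end TFHJ

theorem proposition3p3_general (N : ℕ) (T α : ℝ) (hT : 0 < T) (hα₀ : 0 < α) (hα₁ : α < 1)
    (H : TFHJ.Space N → TFHJ.Space N → ℝ) (u₀ : TFHJ.Space N → ℝ)
    (hH : TFHJ.IsLocallyBUC H) (hA1 : TFHJ.Coercive H) (hA3 : TFHJ.LipBUC u₀) :
    (∃ ω : ℝ → ℝ, TFHJ.IsModulus ω ∧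
      ∀ ε : ℝ, 0 < ε → ∀ u : TFHJ.Space N → ℝ → ℝ,
        TFHJ.IsViscositySolution T α ε H u₀ u → TFHJ.IsBounded T u →
        ∀ (x y : TFHJ.Space N), ∀ t ∈ Set.Icc 0 T, |u x t - u y t| ≤ ω ‖x - y‖) ∧
    (TFHJ.LinearGrowth H →
      (∃ C : ℝ, 0 < C ∧
        ∀ ε : ℝ, 0 < ε → ∀ u : TFHJ.Space N → ℝ → ℝ,
          TFHJ.IsViscositySolution T α ε H u₀ u → TFHJ.IsBounded T u →
          ∀ (x y : TFHJ.Space N), ∀ t ∈ Set.Icc 0 T,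
            |u x t - u y t| ≤ C * (1 + |Real.log ‖x - y‖|) * ‖x - y‖) ∧
      ∀ ν : ℝ, 0 < ν → ν < 1 →
        ∃ C : ℝ, 0 < C ∧
          ∀ ε : ℝ, 0 < ε → ∀ u : TFHJ.Space N → ℝ → ℝ,
            TFHJ.IsViscositySolution T α ε H u₀ u → TFHJ.IsBounded T u →
            ∀ (x y : TFHJ.Space N), ∀ t ∈ Set.Icc 0 T,
              |u x t - u y t| ≤ C * ‖x - y‖ ^ ν) := by
  refine ⟨TFHJ.exists_isModulus_hasSpaceModulus hT hα₀ hα₁ hH hA1 hA3, fun hG => ?_⟩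
  obtain ⟨C, hC, hlog⟩ := TFHJ.exists_hasSpaceModulus_log hT hα₀ hα₁ hH hA1 hA3 hG
  exact ⟨⟨C, hC, hlog⟩, fun ν hν₀ hν₁ =>
    TFHJ.exists_hasSpaceModulus_rpow hT.le hα₀ hα₁ hH hA3 hC hlog hν₀.le hν₁⟩

theorem proposition3p3 (N : ℕ) (T α : ℝ) (hT : 0 < T) (hα₀ : 0 < α) (hα₁ : α < 1)
    (H : TFHJ.Space N → TFHJ.Space N → ℝ) (u₀ : TFHJ.Space N → ℝ)
    (hH : Continuous (Function.uncurry H))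
    (hA1 : TFHJ.Coercive H) (hA2 : TFHJ.Periodic H) (hA3 : TFHJ.LipBUC u₀) :
    (∃ ω : ℝ → ℝ, TFHJ.IsModulus ω ∧
      ∀ ε : ℝ, 0 < ε → ∀ u : TFHJ.Space N → ℝ → ℝ,
        TFHJ.IsViscositySolution T α ε H u₀ u → TFHJ.IsBounded T u →
        ∀ (x y : TFHJ.Space N), ∀ t ∈ Set.Icc 0 T, |u x t - u y t| ≤ ω ‖x - y‖) ∧
    (TFHJ.LinearGrowth H →
      (∃ C : ℝ, 0 < C ∧
        ∀ ε : ℝ, 0 < ε → ∀ u : TFHJ.Space N → ℝ → ℝ,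
          TFHJ.IsViscositySolution T α ε H u₀ u → TFHJ.IsBounded T u →
          ∀ (x y : TFHJ.Space N), ∀ t ∈ Set.Icc 0 T,
            |u x t - u y t| ≤ C * (1 + |Real.log ‖x - y‖|) * ‖x - y‖) ∧
      ∀ ν : ℝ, 0 < ν → ν < 1 →
        ∃ C : ℝ, 0 < C ∧
          ∀ ε : ℝ, 0 < ε → ∀ u : TFHJ.Space N → ℝ → ℝ,
            TFHJ.IsViscositySolution T α ε H u₀ u → TFHJ.IsBounded T u →
            ∀ (x y : TFHJ.Space N), ∀ t ∈ Set.Icc 0 T,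
              |u x t - u y t| ≤ C * ‖x - y‖ ^ ν) :=
  proposition3p3_general N T α hT hα₀ hα₁ H u₀ (hA2.isLocallyBUC hH) hA1 hA3
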